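/- Let $f:M\to M$ be a homeomorphism of a compact metric space $(M,\rho)$ (for instance a compact Riemannian manifold with its distance), and let $\varphi:M\to\mathbb R$ be continuous. A sequence $\{x_n\}_{n\in\mathbb Z}$ in $M$ is an $\varepsilon$-trajectory if $\rho(f(x_n),x_{n+1})<\varepsilon$ for all $n$; it is $p$-periodic ($p\ge 1$) if $x_{n+p}=x_n$ for all $n$. A point is chain recurrent if for every $\varepsilon>0$ it lies on a periodic $\varepsilon$-trajectory; two chain recurrent points are equivalent if for every $\varepsilon>0$ some periodic $\varepsilon$-trajectory passes through both. Let $\Omega$ be a component of the chain recurrent set, that is, an equivalence class. Let $\mathcal M(\Omega)$ be the set of $f$-invariant Borel probability measures $\mu$ on $M$ with $\mu(M\setminus\Omega)=0$, with the weak topology. The spectrum of the averaging of $\varphi$ over $\Omega$ is the set of all limits $\lim_k \frac1{p_k}\sum_{i=0}^{p_k-1}\varphi(x^k_i)$, where $\varepsilon_k\to0$ and $\{x^k_n\}_n$ is a $p_k$-periodic $\varepsilon_k$-trajectory contained in $\Omega$. Theorem 10. The spectrum of the averaging of $\varphi$ over $\Omega$ is a closed interval $[a,b]$ with $a\le b$,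 and it equals $\{\int_M\varphi\,d\mu:\mu\in\mathcal M(\Omega)\}$, so that $a=\min_{\mathcal M(\Omega)}\int_M\varphi\,d\mu$ and $b=\max_{\mathcal M(\Omega)}\int_M\varphi\,d\mu$. Moreover: 1. The set $\mathcal M(b)=\{\mu\in\mathcal M(\Omega):\int_M\varphi\,d\mu=b\}$ is nonempty, convex and compact. 2. The extreme points of $\mathcal M(b)$ are exactly the ergodic measures $\mu^*\in\mathcal M(\Omega)$ with $\int_M\varphi\,d\mu^*=b$. 3. For every $\mu\in\mathcal M(b)$ there are a standard Borel space $A$ with a probability measure $\beta$, a family of pairwise disjoint measurable sets $\Omega_\alpha\subset M$ ($\alpha\in A$) with $f^{-1}(\Omega_\alpha)=\Omega_\alpha$ and $\mu(M\setminus\bigcup_\alpha\Omega_\alpha)=0$ such that $\bigcup_{\alpha\in B}\Omega_\alpha$ is measurable for every measurable $B\subset A$, and a measurable family of ergodic measures $\mu_\alpha\in\operatorname{ext}\mathcal M(b)$ with $\mu_\alpha(M\setminus\Omega_\alpha)=0$, such that for every $\mu$-integrable $\theta:M\to\mathbb R$ the function $\theta$ is $\mu_\alpha$-integrable for $\beta$-almost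 every $\alpha$, the function $\alpha\mapsto\int_M\theta\,d\mu_\alpha$ is $\beta$-integrable, and $$\int_M\theta\,d\mu=\int_A\Big(\int_M\theta\,d\mu_\alpha\Big)d\beta(\alpha).$$ The same three assertions hold with $b$ replaced by $a$. -/

import Mathlib

open MeasureTheory Set Filter Topology
open scoped NNReal

namespace ChainAverage

section Chains

variable {M : Type*} [MetricSpace M]

/-- A doubly infinite sequence with `ρ (f (ξ n)) (ξ (n + 1)) < ε` for all `n`. -/
def IsPseudotrajectory (f : M → M) (ε : ℝ) (ξ : ℤ → M) : Prop :=
  ∀ n : ℤ, dist (f (ξ n)) (ξ (n + 1)) < ε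

/-- A `p`-periodic `ε`-trajectory, with `p ≥ 1`. -/
def IsPeriodicPseudotrajectory (f : M → M) (ε : ℝ) (p : ℕ) (ξ : ℤ → M) : Prop :=
  0 < p ∧ IsPseudotrajectory f ε ξ ∧ ∀ n : ℤ, ξ (n + (p : ℤ)) = ξ n

/-- Points lying on periodic `ε`-trajectories for every `ε > 0`. -/
def chainRecurrentSet (f : M → M) : Set M :=
  {x | ∀ ε : ℝ, 0 < ε → ∃ (p : ℕ) (ξ : ℤ → M),
    IsPeriodicPseudotrajectory f ε p ξ ∧ x ∈ range ξ}

/-- For every `ε > 0` some periodic `ε`-trajectory passes through both points. -/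
def ChainEquivalent (f : M → M) (x y : M) : Prop :=
  ∀ ε : ℝ, 0 < ε → ∃ (p : ℕ) (ξ : ℤ → M),
    IsPeriodicPseudotrajectory f ε p ξ ∧ x ∈ range ξ ∧ y ∈ range ξ

/-- A component of the chain recurrent set: a class of equivalent chain recurrent points. -/
def IsChainComponent (f : M → M) (Ω : Set M) : Prop :=
  ∃ x ∈ chainRecurrentSet f, Ω = {y | y ∈ chainRecurrentSet f ∧ ChainEquivalent f x y}

/-- The mean of `φ` over one period of a `p`-periodic sequence. -/
noncomputable def periodAverage (φ : M → ℝ) (p : ℕ) (ξ : ℤ → M) : ℝ :=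
  (∑ i ∈ Finset.range p, φ (ξ (i : ℤ))) / (p : ℝ)

/-- The spectrum of the averaging of `φ` over `Ω`: all limits, as `ε → 0`, of means of `φ`
over periodic `ε`-trajectories of `Ω`. -/
def averagingSpectrum (f : M → M) (φ : M → ℝ) (Ω : Set M) : Set ℝ :=
  {c | ∃ (ε : ℕ → ℝ) (p : ℕ → ℕ) (ξ : ℕ → ℤ → M),
    Tendsto ε atTop (𝓝 0) ∧
    (∀ k, IsPeriodicPseudotrajectory f (ε k) (p k) (ξ k) ∧ ∀ n, ξ k n ∈ Ω) ∧
    Tendsto (fun k => periodAverage φ (p k) (ξ k)) atTop (𝓝 c)}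

end Chains

section Measures

variable {M : Type*} [MeasurableSpace M]

/-- The `f`-invariant probability measures concentrated on `Ω`. They are regarded as elements of
`FiniteMeasure M`, which carries the topology of weak convergence and convex combinations. -/
def invariantMeasures (f : M → M) (Ω : Set M) : Set (FiniteMeasure M) :=
  {μ | IsProbabilityMeasure (μ : Measure M) ∧
    MeasurePreserving f (μ : Measure M) (μ : Measure M) ∧ (μ : Measure M) Ωᶜ = 0}

/-- The measures of `invariantMeasures f Ω` with `∫ φ dμ = c`. -/
def levelMeasures (f : M → M) (φ : M → ℝ) (Ω : Set M) (c : ℝ) : Set (FiniteMeasure M) :=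
  {μ | μ ∈ invariantMeasures f Ω ∧ ∫ x, φ x ∂(μ : Measure M) = c}

/-- `μ` decomposes into ergodic components belonging to `E`: up to a null set, `M` is divided into
the disjoint invariant measurable sets `S α`, indexed by a standard probability space `(A, β)`,
and `S α` carries the ergodic measure `κ α ∈ E`, so that `μ` is the `β`-integral of the `κ α`. -/
def HasErgodicDecomposition (f : M → M) (E : Set (FiniteMeasure M)) (μ : FiniteMeasure M) :
    Prop :=
  ∃ (A : Type) (_ : MeasurableSpace A) (_ : StandardBorelSpace A) (β : Measure A)
    (S : A → Set M) (κ : A → FiniteMeasure M),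
    IsProbabilityMeasure β ∧
    (∀ α, MeasurableSet (S α) ∧ f ⁻¹' S α = S α) ∧
    Pairwise (fun α α' => Disjoint (S α) (S α')) ∧
    (∀ B : Set A, MeasurableSet B → MeasurableSet (⋃ α ∈ B, S α)) ∧
    (μ : Measure M) (⋃ α, S α)ᶜ = 0 ∧
    Measurable (fun α => (κ α : Measure M)) ∧
    (∀ α, κ α ∈ E ∧ Ergodic f (κ α : Measure M) ∧ (κ α : Measure M) (S α)ᶜ = 0) ∧
    ∀ θ : M → ℝ, Integrable θ (μ : Measure M) →
      (∀ᵐ α ∂β, Integrable θ (κ α : Measure M)) ∧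
      Integrable (fun α => ∫ x, θ x ∂(κ α : Measure M)) β ∧
      ∫ x, θ x ∂(μ : Measure M) = ∫ α, (∫ x, θ x ∂(κ α : Measure M)) ∂β

end Measures

end ChainAverage

namespace ChainAverage

/-! The spectrum equals the set of integrals against measures in $\mathcal M(\Omega)$. One inclusion
is weak compactness: a weak limit of the uniform measures on finer and finer periodic trajectories
of $\Omega$ is invariant, because shifting a periodic sequence leaves its mean unchanged, and it
lives on the closed set $\Omega$ (`exists_invariantMeasure_of_mem_averagingSpectrum`). For the
converse, $\int\sum_{i<n}\varphi\circ f^i\,d\mu=n\int\varphi\,d\mu$, so for every $n$ some orbit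
segment in $\Omega$ has mean at least $\int\varphi\,d\mu$ and some has mean at most that; no ergodic
theorem is needed. Chains inside $\Omega$ of length bounded independently of $n$ close these
segments up into loops through one point, and repeating a high loop and a low loop in the right
proportion yields any intermediate mean (`exists_loop_ge`, `WChain.exists_mean_near`). That chains
can be kept inside $\Omega$ is `IsChainComponent.exists_wChain`.

Since $\mathcal M(\Omega)$ is convex and compact, the set of integrals is a closed interval. At an
endpoint $c$ the level set is a face of $\mathcal M(\Omega)$: a mixture reaches the extreme value
only if its parts do. Hence extreme points of the level set are ergodic, and almost all ergodic
components of a measure in it stay in it.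

The ergodic decomposition comes from disintegrating $\mu$ along an invariant map $F$ into $\mathbb
R^{\mathbb N}$ that records limits of Birkhoff averages of a countable generating π-system. The mean
ergodic theorem in $L^2$, with almost everywhere convergence along subsequences, is enough. -/

theorem apply_add_mul_of_periodic {α : Type*} {p : ℕ} {ξ : ℤ → α} (h : ∀ n : ℤ, ξ (n + (p : ℤ)) = ξ n)
    (n : ℤ) (k : ℕ) : ξ (n + k * p) = ξ n := by
  induction k with
  | zero => simp
  | succ k ih =>
    rw [← ih, ← h (n + k * p)]
    congr 1
    push_cast
    ring

/-! ### Chains and periodic pseudotrajectories -/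

section Chains

variable {M : Type*} [MetricSpace M]

/-- One step of an `ε`-trajectory. -/
def Step (f : M → M) (ε : ℝ) (x y : M) : Prop := dist (f x) y < ε

/-- There is an `ε`-chain with at least one step from `x` to `y`. -/
abbrev Reach (f : M → M) (ε : ℝ) : M → M → Prop := Relation.TransGen (Step f ε)

theorem Step.mono {f : M → M} {ε δ : ℝ} (h : ε ≤ δ) {x y : M} (hx : Step f ε x y) :
    Step f δ x y := lt_of_lt_of_le hx h

theorem Reach.mono {f : M → M} {ε δ : ℝ} (h : ε ≤ δ) {x y : M} (hx : Reach f ε x y) :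
    Reach f δ x y := Relation.TransGen.mono (fun _ _ => Step.mono h) _ _ hx

theorem Reach.perturb_right {f : M → M} {ε δ : ℝ} (hδ : 0 ≤ δ) {x y y' : M}
    (h : Reach f ε x y) (hy : dist y y' ≤ δ) : Reach f (ε + δ) x y' := by
  have key : ∀ {z}, Step f ε z y → Step f (ε + δ) z y' := fun {z} hz => by
    have := dist_triangle (f z) y y'
    unfold Step at *
    linarith
  cases h with
  | single h => exact .single (key h)
  | tail h1 h2 => exact (Reach.mono (by linarith) h1).tail (key h2)

theorem Reach.perturb_left {f : M → M} {ε δ : ℝ} (hδ : 0 ≤ δ) {x x' y : M}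
    (h : Reach f ε x y) (hx : dist (f x') (f x) ≤ δ) : Reach f (ε + δ) x' y := by
  obtain ⟨z, hz, hzy⟩ := Relation.TransGen.head'_iff.1 h
  have h1 : Step f (ε + δ) x' z := by
    have := dist_triangle (f x') (f x) z
    unfold Step at *
    linarith
  exact Relation.TransGen.head'_iff.2
    ⟨z, h1, Relation.ReflTransGen.mono (fun _ _ => Step.mono (by linarith)) _ _ hzy⟩

theorem reach_of_function {f : M → M} {ε : ℝ} {ξ : ℤ → M} (h : IsPseudotrajectory f ε ξ)
    (m : ℤ) (n : ℕ) : Reach f ε (ξ m) (ξ (m + (n + 1 : ℕ))) := by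
  induction n with
  | zero => exact .single (by simpa [Step] using h m)
  | succ n ih =>
    refine ih.tail ?_
    have := h (m + (n + 1 : ℕ))
    rw [add_assoc] at this
    exact_mod_cast this

theorem IsPeriodicPseudotrajectory.reach {f : M → M} {ε : ℝ} {p : ℕ} {ξ : ℤ → M}
    (h : IsPeriodicPseudotrajectory f ε p ξ) (m n : ℤ) : Reach f ε (ξ m) (ξ n) := by
  obtain ⟨hp, hξ, hper⟩ := h
  -- Adding $|m-n|+1$ periods moves the index `n` strictly past `m`, since `p ≥ 1`.
  obtain ⟨j, hj⟩ : ∃ j : ℕ, n + ((m - n).natAbs + 1 : ℕ) * p = m + (j + 1 : ℕ) := by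
    have h1 : (1 : ℤ) ≤ p := by exact_mod_cast hp
    have h2 : (m - n) + 1 ≤ ((m - n).natAbs + 1 : ℕ) * (p : ℤ) := by
      have : (m - n) ≤ (m - n).natAbs := Int.le_natAbs
      push_cast
      nlinarith [abs_nonneg (m - n), le_abs_self (m - n)]
    refine ⟨(n + ((m - n).natAbs + 1 : ℕ) * p - m - 1).toNat, ?_⟩
    push_cast at *
    omega
  rw [← apply_add_mul_of_periodic hper n ((m - n).natAbs + 1), hj]
  exact reach_of_function hξ m j

/-- A finite `ε`-chain in `S` with `n` steps from `x` to `y`, along which the sum of `φ`, the last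
point being left out, is `s`. -/
inductive WChain (f : M → M) (φ : M → ℝ) (ε : ℝ) (S : Set M) : ℕ → ℝ → M → M → Prop
  | nil {x : M} (hx : x ∈ S) : WChain f φ ε S 0 0 x x
  | cons {x y z : M} {n : ℕ} {s : ℝ} (hx : x ∈ S) (h : Step f ε x y)
      (hc : WChain f φ ε S n s y z) : WChain f φ ε S (n + 1) (φ x + s) x z

namespace WChain

variable {f : M → M} {φ : M → ℝ} {ε : ℝ} {S : Set M} {n m : ℕ} {s t : ℝ} {x y z : M}

theorem trans (h : WChain f φ ε S n s x y) (h' : WChain f φ ε S m t y z) :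
    WChain f φ ε S (n + m) (s + t) x z := by
  induction h with
  | nil => simpa using h'
  | cons hx h _ ih =>
    convert! cons hx h (ih h') using 1
    · omega
    · ring

theorem mem_left (h : WChain f φ ε S n s x y) : x ∈ S := by cases h <;> assumption

theorem mem_right (h : WChain f φ ε S n s x y) : y ∈ S := by
  induction h <;> assumption

theorem single (hx : x ∈ S) (hy : y ∈ S) (h : Step f ε x y) :
    WChain f φ ε S 1 (φ x) x y := by
  simpa using cons (φ := φ) hx h (nil hy)

theorem abs_le {C : ℝ} (hC : ∀ x, |φ x| ≤ C) (h : WChain f φ ε S n s x y) : |s| ≤ n * C := by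
  induction h with
  | nil => simp
  | @cons x y z n s hx h _ ih =>
    have := abs_add_le (φ x) s
    have := hC x
    push_cast
    linarith

theorem orbit (hS : ∀ x ∈ S, f x ∈ S) (hε : 0 < ε) (hx : x ∈ S) (n : ℕ) :
    WChain f φ ε S n (∑ i ∈ Finset.range n, φ (f^[i] x)) x (f^[n] x) := by
  induction n generalizing x with
  | zero => simpa using nil hx
  | succ n ih =>
    rw [Finset.sum_range_succ', add_comm (Finset.sum _ _)]
    exact cons hx (by simpa [Step] using hε) (ih (hS x hx))

theorem neg (h : WChain f (fun x => - φ x) ε S n s x y) : WChain f φ ε S n (-s) x y := by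
  induction h with
  | nil hx => simpa using nil hx
  | cons hx h _ ih =>
    convert! cons hx h ih using 1
    ring

theorem iterate (h : WChain f φ ε S n s x x) (k : ℕ) : WChain f φ ε S (k * n) (k * s) x x := by
  induction k with
  | zero => simpa using nil h.mem_left
  | succ k ih =>
    convert! ih.trans h using 1
    · ring
    · push_cast; ring

/-- Realizes a chain as an initial segment of a sequence, so that two successive applications lay
out two concatenated chains. -/
theorem exists_extend (h : WChain f φ ε S n s x y) {ξ' : ℕ → M} (h0' : ξ' 0 = y)
    (hm' : ∀ i, ξ' i ∈ S) (hs' : ∀ i < m, Step f ε (ξ' i) (ξ' (i + 1))) :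
    ∃ ξ : ℕ → M, ξ 0 = x ∧ (∀ i, ξ (n + i) = ξ' i) ∧ (∀ i, ξ i ∈ S) ∧
      (∀ i < n + m, Step f ε (ξ i) (ξ (i + 1))) ∧ ∑ i ∈ Finset.range n, φ (ξ i) = s := by
  induction h with
  | @nil x hx => exact ⟨ξ', h0', by simp, hm', by simpa using hs', by simp⟩
  | @cons x y z n s hx h _ ih =>
    obtain ⟨ξ, h0, hn, hm, hs, hsum⟩ := ih h0'
    refine ⟨fun i => Nat.casesOn i x ξ, rfl, fun i => ?_, ?_, ?_, ?_⟩
    · rw [add_right_comm]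
      exact hn i
    · rintro (_ | i)
      exacts [hx, hm i]
    · rintro (_ | i) hi
      · simpa [h0] using h
      · exact hs i (by omega)
    · rw [Finset.sum_range_succ', add_comm, ← hsum]
      rfl

theorem exists_periodic (h : WChain f φ ε S n s x y) (h' : WChain f φ ε S m t y x)
    (hn : 0 < n + m) :
    ∃ ξ : ℤ → M, IsPeriodicPseudotrajectory f ε (n + m) ξ ∧ (∀ i, ξ i ∈ S) ∧ x ∈ range ξ ∧
      y ∈ range ξ ∧ periodAverage φ (n + m) ξ = (s + t) / (n + m : ℕ) := by
  -- The tail after the closed chain is the constant `x`; with `m := 0` no step condition is imposed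
  -- on it.
  obtain ⟨ξ', h0', hm1, hξ', hs', hsum'⟩ :=
    h'.exists_extend (ξ' := fun _ => x) (m := 0) rfl (fun _ => h.mem_left) (by simp)
  obtain ⟨ξ, h0, hadd, hξ, hs, hsum⟩ := h.exists_extend h0' hξ' hs'
  have hsum2 : ∑ i ∈ Finset.range (n + m), φ (ξ i) = s + t := by
    rw [Finset.sum_range_add, hsum]
    simp only [hadd, hsum']
  have hend : ξ (n + m) = x := by rw [hadd]; exact hm1 0
  have hy : ξ n = y := by rw [← h0', ← hadd 0, add_zero]
  clear hsum hadd hs' hsum' hm1 hξ' h0'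
  rw [add_zero] at hs
  obtain ⟨N, hN⟩ : ∃ N, n + m = N := ⟨_, rfl⟩
  have hnN : n ≤ N := by omega
  rw [hN] at hn hs hsum2 hend ⊢
  have hn' : (0 : ℤ) < N := by exact_mod_cast hn
  refine ⟨fun k => ξ (k % N).toNat, ⟨hn, ?_, ?_⟩, fun _ => hξ _, ⟨0, by simpa using h0⟩, ?_, ?_⟩
  · intro k
    have h1 := Int.emod_nonneg k hn'.ne'
    have h2 := Int.emod_lt_of_pos k hn'
    have hstep := hs (k % N).toNat (by omega)
    have hmod : (k + 1) % N = (k % N + 1) % N := by simp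
    rcases eq_or_ne (k % N + 1) N with h3 | h3
    · have h4 : (k + 1) % N = 0 := by rw [hmod, h3, Int.emod_self]
      have h5 : (k % N).toNat + 1 = N := by omega
      rw [h5, hend, ← h0] at hstep
      simp only [h4]
      exact hstep
    · have h4 : (k + 1) % N = k % N + 1 := by
        rw [hmod]
        exact Int.emod_eq_of_lt (by omega) (by omega)
      have h5 : (k % N + 1).toNat = (k % N).toNat + 1 := by omega
      simp only [h4, h5]
      exact hstep
  · intro k
    simp
  -- If the return chain is empty, then `y = x`, which sits at index `0` since `n` reduces to `0`
  -- modulo `N`.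
  · rcases hnN.lt_or_eq with h1 | h1
    · refine ⟨n, ?_⟩
      simp only
      rw [Int.emod_eq_of_lt (by omega) (by omega), Int.toNat_natCast, hy]
    · refine ⟨0, ?_⟩
      rw [← hy, h1, hend]
      simpa using h0
  · unfold periodAverage
    rw [← hsum2]
    congr 1
    refine Finset.sum_congr rfl fun i hi => ?_
    rw [Finset.mem_range] at hi
    simp only
    rw [Int.emod_eq_of_lt (by omega) (by omega), Int.toNat_natCast]

theorem exists_of_transGen
    (h : Relation.TransGen (fun x y => x ∈ S ∧ y ∈ S ∧ Step f ε x y) x y) :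
    ∃ n s, 0 < n ∧ WChain f φ ε S n s x y := by
  induction h with
  | single h => exact ⟨1, _, one_pos, single h.1 h.2.1 h.2.2⟩
  | tail _ h ih =>
    obtain ⟨n, s, hn, hc⟩ := ih
    exact ⟨_, _, by omega, hc.trans (single h.1 h.2.1 h.2.2)⟩

theorem mono {δ : ℝ} (hεδ : ε ≤ δ) (h : WChain f φ ε S n s x y) : WChain f φ δ S n s x y := by
  induction h with
  | nil hx => exact nil hx
  | cons hx h _ ih => exact cons hx (h.mono hεδ) ih

theorem perturb_left {x' : M} (h : WChain f φ ε S n s x y) (hn : 0 < n) (hx : x' ∈ S)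
    {δ : ℝ} (hδ : 0 ≤ δ) (hd : dist (f x') (f x) ≤ δ) :
    ∃ s', WChain f φ (ε + δ) S n s' x' y := by
  cases h with
  | nil => omega
  | @cons x z y n s _ h hc =>
    refine ⟨_, cons hx ?_ (hc.mono (by linarith))⟩
    have := dist_triangle (f x') (f x) z
    unfold Step at *
    linarith

theorem perturb_right {y' : M} (h : WChain f φ ε S n s x y) (hn : 0 < n) (hy : y' ∈ S)
    {δ : ℝ} (hδ : 0 ≤ δ) (hd : dist y y' ≤ δ) :
    ∃ s', WChain f φ (ε + δ) S n s' x y' := by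
  induction h with
  | nil => omega
  | @cons x z y n s hx h hc ih =>
    rcases Nat.eq_zero_or_pos n with rfl | hn'
    · cases hc
      refine ⟨_, single hx hy ?_⟩
      have := dist_triangle (f x) z y'
      unfold Step at *
      linarith
    · obtain ⟨s', h'⟩ := ih hn' hd
      exact ⟨_, cons hx (h.mono (by linarith)) h'⟩

end WChain

theorem Reach.exists_wChain_univ {f : M → M} {ε : ℝ} {x y : M} (h : Reach f ε x y) :
    ∃ n s, 0 < n ∧ WChain f (fun _ => 0) ε univ n s x y :=
  WChain.exists_of_transGen (Relation.TransGen.mono (fun _ _ h => ⟨trivial, trivial, h⟩) _ _ h)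

theorem chainEquivalent_iff {f : M → M} {x y : M} :
    ChainEquivalent f x y ↔ ∀ ε : ℝ, 0 < ε → Reach f ε x y ∧ Reach f ε y x := by
  constructor
  · intro h ε hε
    obtain ⟨p, ξ, hξ, ⟨m, rfl⟩, ⟨n, rfl⟩⟩ := h ε hε
    exact ⟨hξ.reach m n, hξ.reach n m⟩
  · intro h ε hε
    obtain ⟨h1, h2⟩ := h ε hε
    obtain ⟨n, s, hn, hc⟩ := h1.exists_wChain_univ
    obtain ⟨m, t, hm, hc'⟩ := h2.exists_wChain_univ
    obtain ⟨ξ, hξ, -, hx, hy, -⟩ := hc.exists_periodic hc' (by omega)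
    exact ⟨_, ξ, hξ, hx, hy⟩

/-- A point equivalent to `x` is itself on the periodic trajectories involved, so its chain
recurrence is automatic and only mutual reachability remains. -/
theorem exists_reach_of_mem_isChainComponent {f : M → M} {Ω : Set M} (hΩ : IsChainComponent f Ω) :
    ∃ x ∈ Ω, ∀ y, y ∈ Ω ↔ ∀ ε : ℝ, 0 < ε → Reach f ε x y ∧ Reach f ε y x := by
  obtain ⟨x, hx, rfl⟩ := hΩ
  have key : ∀ y, (y ∈ chainRecurrentSet f ∧ ChainEquivalent f x y) ↔
      ∀ ε : ℝ, 0 < ε → Reach f ε x y ∧ Reach f ε y x := fun y => by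
    rw [← chainEquivalent_iff]
    refine ⟨And.right, fun h => ⟨fun ε hε => ?_, h⟩⟩
    obtain ⟨p, ξ, hξ, -, hy⟩ := h ε hε
    exact ⟨p, ξ, hξ, hy⟩
  refine ⟨x, ⟨hx, fun ε hε => ?_⟩, key⟩
  obtain ⟨p, ξ, hξ, hy⟩ := hx ε hε
  exact ⟨p, ξ, hξ, hy, hy⟩

end Chains

/-! ### Chain components: closedness, invariance, internal chains -/

section Components

variable {M : Type*} [MetricSpace M] [CompactSpace M] {f : M → M} {Ω : Set M}

namespace IsChainComponent

omit [CompactSpace M] in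
theorem reach (hΩ : IsChainComponent f Ω) {x y : M} (hx : x ∈ Ω) (hy : y ∈ Ω) {ε : ℝ}
    (hε : 0 < ε) : Reach f ε x y := by
  obtain ⟨x₀, -, h⟩ := exists_reach_of_mem_isChainComponent hΩ
  exact ((h x).1 hx ε hε).2.trans ((h y).1 hy ε hε).1

omit [CompactSpace M] in
theorem mem_of_reach (hΩ : IsChainComponent f Ω) {x y : M} (hx : x ∈ Ω)
    (h : ∀ ε : ℝ, 0 < ε → Reach f ε x y ∧ Reach f ε y x) : y ∈ Ω := by
  obtain ⟨x₀, -, h₀⟩ := exists_reach_of_mem_isChainComponent hΩ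
  refine (h₀ y).2 fun ε hε => ?_
  have h1 := (h₀ x).1 hx ε hε
  exact ⟨h1.1.trans (h ε hε).1, (h ε hε).2.trans h1.2⟩

omit [CompactSpace M] in
theorem nonempty (hΩ : IsChainComponent f Ω) : Ω.Nonempty := by
  obtain ⟨x₀, h, -⟩ := exists_reach_of_mem_isChainComponent hΩ
  exact ⟨x₀, h⟩

omit [CompactSpace M] in
/-- A limit of points on chains through `x`, with the chains becoming finer, is in the component
of `x`. -/
theorem mem_of_tendsto (hf : Continuous f) (hΩ : IsChainComponent f Ω) {x z : M} (hx : x ∈ Ω)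
    {ε : ℕ → ℝ} {u : ℕ → M} (hε : Tendsto ε atTop (𝓝 0)) (hu : Tendsto u atTop (𝓝 z))
    (h : ∀ k, Reach f (ε k) x (u k) ∧ Reach f (ε k) (u k) x) : z ∈ Ω := by
  refine hΩ.mem_of_reach hx fun δ hδ => ?_
  have h1 : ∀ᶠ k in atTop, ε k < δ / 2 := hε.eventually_lt_const (by linarith)
  have h2 : ∀ᶠ k in atTop, dist (u k) z < δ / 2 :=
    (tendsto_iff_dist_tendsto_zero.1 hu).eventually_lt_const (by linarith)
  have h3 : ∀ᶠ k in atTop, dist (f (u k)) (f z) < δ / 2 :=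
    (tendsto_iff_dist_tendsto_zero.1 ((hf.tendsto z).comp hu)).eventually_lt_const (by linarith)
  obtain ⟨k, hk1, hk2, hk3⟩ := (h1.and (h2.and h3)).exists
  have hδ2 : 0 ≤ δ / 2 := by linarith
  refine ⟨((h k).1.perturb_right hδ2 hk2.le).mono (by linarith),
    ((h k).2.perturb_left hδ2 ?_).mono (by linarith)⟩
  rw [dist_comm]
  exact hk3.le

omit [CompactSpace M] in
theorem isClosed (hf : Continuous f) (hΩ : IsChainComponent f Ω) : IsClosed Ω := by
  obtain ⟨x, hx⟩ := hΩ.nonempty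
  refine IsSeqClosed.isClosed fun u z hu hz => ?_
  have hε : ∀ k : ℕ, (0 : ℝ) < 1 / ((k : ℝ) + 1) := fun k => by positivity
  exact hΩ.mem_of_tendsto hf hx tendsto_one_div_add_atTop_nhds_zero_nat hz
    fun k => ⟨hΩ.reach hx (hu k) (hε k), hΩ.reach (hu k) hx (hε k)⟩

omit [CompactSpace M] in
-- To return from `f x` to `x`, take a fine loop at `x`. Its first point `w` is close to `f x`, so
-- by continuity the rest of the loop can be started at `f x` instead.
theorem map_mem (hf : Continuous f) (hΩ : IsChainComponent f Ω) {x : M} (hx : x ∈ Ω) :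
    f x ∈ Ω := by
  refine hΩ.mem_of_reach hx fun ε hε => ⟨.single (by simpa [Step] using hε), ?_⟩
  obtain ⟨δ, hδ, hd⟩ := Metric.continuousAt_iff.1 (hf.continuousAt (x := f x)) (ε / 2) (half_pos hε)
  have hη : 0 < min (ε / 2) δ := lt_min (half_pos hε) hδ
  have hloop := hΩ.reach hx hx hη
  obtain ⟨w, hw, hwx⟩ := Relation.TransGen.head'_iff.1 hloop
  have hw' : Reach f (min (ε / 2) δ) w x := hloop.trans_right hwx
  have h1 : dist w (f x) < δ := by
    rw [dist_comm]
    exact lt_of_lt_of_le hw (min_le_right _ _)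
  refine (hw'.perturb_left (half_pos hε).le ?_).mono
    (by linarith [min_le_left (ε / 2) δ])
  rw [dist_comm]
  exact (hd h1).le

/-- Sufficiently fine chains from a point of the component to itself stay near the component. -/
theorem exists_near (hf : Continuous f) (hΩ : IsChainComponent f Ω) {x : M} (hx : x ∈ Ω)
    {η : ℝ} (hη : 0 < η) : ∃ ε : ℝ, 0 < ε ∧
      ∀ z, Reach f ε x z → Reach f ε z x → ∃ w ∈ Ω, dist z w < η := by
  by_contra! H
  have hε : ∀ k : ℕ, (0 : ℝ) < 1 / ((k : ℝ) + 1) := fun k => by positivity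
  choose u hu1 hu2 hu3 using fun k => H _ (hε k)
  obtain ⟨z, -, θ, hθ, hz⟩ := isCompact_univ.tendsto_subseq fun k => mem_univ (u k)
  have hzΩ : z ∈ Ω := hΩ.mem_of_tendsto hf hx
    (tendsto_one_div_add_atTop_nhds_zero_nat.comp hθ.tendsto_atTop) hz
    fun k => ⟨hu1 _, hu2 _⟩
  obtain ⟨k, hk⟩ := ((tendsto_iff_dist_tendsto_zero.1 hz).eventually_lt_const hη).exists
  exact absurd hk (hu3 _ z hzΩ).not_gt

/-- Any two points of the component are joined by chains inside the component. -/
theorem exists_wChain (hf : Continuous f) (hΩ : IsChainComponent f Ω) (φ : M → ℝ) {x y : M}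
    (hx : x ∈ Ω) (hy : y ∈ Ω) {ε : ℝ} (hε : 0 < ε) :
    ∃ n s, 0 < n ∧ WChain f φ ε Ω n s x y := by
  apply WChain.exists_of_transGen
  have hε3 : 0 < ε / 3 := by linarith
  obtain ⟨η, hη, hfη⟩ := Metric.uniformContinuous_iff.1
    (CompactSpace.uniformContinuous_of_continuous hf) (ε / 3) hε3
  obtain ⟨δ, hδ, hnear⟩ := hΩ.exists_near hf hx (lt_min hη hε3)
  set ρ := min δ (ε / 3)
  have hρ : 0 < ρ := lt_min hδ hε3
  -- Induction along a fine loop through `x`: each point is replaced by a nearby point of `Ω`. A new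
  -- step has three errors of at most `ε / 3`: moving its start (after applying `f`), the old step,
  -- and moving its end.
  have key : ∀ z, Reach f ρ x z → Reach f ρ z x → ∀ w ∈ Ω, dist z w < min η (ε / 3) →
      Relation.TransGen (fun x y => x ∈ Ω ∧ y ∈ Ω ∧ Step f ε x y) x w := by
    intro z hz
    induction hz with
    | @single z hxz =>
      intro _ w hw hzw
      refine .single ⟨hx, hw, ?_⟩
      have h1 := dist_triangle (f x) z w
      have h2 := lt_of_lt_of_le hxz (min_le_right _ _)
      have h3 := lt_of_lt_of_le hzw (min_le_right _ _)
      unfold Step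
      linarith
    | @tail z z' hz hzz' ih =>
      intro hz'x w hw hzw
      have hzx : Reach f ρ z x := (Relation.TransGen.single hzz').trans hz'x
      obtain ⟨v, hv, hzv⟩ := hnear z (Reach.mono (min_le_left _ _) hz)
        (Reach.mono (min_le_left _ _) hzx)
      refine (ih hzx v hv hzv).tail ⟨hv, hw, ?_⟩
      have h0 := hfη (lt_of_lt_of_le hzv (min_le_left _ _))
      have h1 := dist_triangle (f v) (f z) w
      have h2 := dist_triangle (f z) z' w
      have h3 := lt_of_lt_of_le hzz' (min_le_right _ _)
      have h4 := lt_of_lt_of_le hzw (min_le_right _ _)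
      unfold Step
      rw [dist_comm (f v) (f z)] at h1
      linarith
  exact key y (hΩ.reach hx hy hρ) (hΩ.reach hy hx hρ) y hy (by simpa using ⟨hη, hε⟩)

/-- The points of the component are reached from `x` inside the component in a bounded number of
steps. -/
theorem exists_bound_from (hf : Continuous f) (hΩ : IsChainComponent f Ω) (φ : M → ℝ) {x : M}
    (hx : x ∈ Ω) {ε : ℝ} (hε : 0 < ε) :
    ∃ N : ℕ, ∀ y ∈ Ω, ∃ n s, n ≤ N ∧ WChain f φ ε Ω n s x y := by
  refine (hΩ.isClosed hf).isCompact.induction_on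
    (p := fun S => ∃ N : ℕ, ∀ y ∈ S, ∃ n s, n ≤ N ∧ WChain f φ ε Ω n s x y) ⟨0, by simp⟩ ?_ ?_ ?_
  · rintro S T hST ⟨N, hN⟩
    exact ⟨N, fun y hy => hN y (hST hy)⟩
  · rintro S T ⟨N, hN⟩ ⟨N', hN'⟩
    refine ⟨max N N', ?_⟩
    rintro y (hy | hy)
    · obtain ⟨n, s, hn, h⟩ := hN y hy
      exact ⟨n, s, by omega, h⟩
    · obtain ⟨n, s, hn, h⟩ := hN' y hy
      exact ⟨n, s, by omega, h⟩
  · intro y hy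
    -- An `ε / 2`-chain to `y` serves all points of `Ω` in a ball about `y`, by moving its endpoint;
    -- compactness then bounds the lengths.
    obtain ⟨m, t, hm, hc⟩ := hΩ.exists_wChain hf φ hx hy (half_pos hε)
    refine ⟨Metric.ball y (ε / 2) ∩ Ω, inter_mem (mem_nhdsWithin_of_mem_nhds
      (Metric.ball_mem_nhds y (half_pos hε))) self_mem_nhdsWithin, m, ?_⟩
    rintro y' ⟨hy', hyΩ⟩
    rw [Metric.mem_ball, dist_comm] at hy'
    obtain ⟨s', h⟩ := hc.perturb_right hm hyΩ (half_pos hε).le hy'.le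
    rw [add_halves] at h
    exact ⟨m, s', le_rfl, h⟩

theorem exists_bound_to (hf : Continuous f) (hΩ : IsChainComponent f Ω) (φ : M → ℝ) {x : M}
    (hx : x ∈ Ω) {ε : ℝ} (hε : 0 < ε) :
    ∃ N : ℕ, ∀ y ∈ Ω, ∃ n s, n ≤ N ∧ WChain f φ ε Ω n s y x := by
  refine (hΩ.isClosed hf).isCompact.induction_on
    (p := fun S => ∃ N : ℕ, ∀ y ∈ S, ∃ n s, n ≤ N ∧ WChain f φ ε Ω n s y x) ⟨0, by simp⟩ ?_ ?_ ?_
  · rintro S T hST ⟨N, hN⟩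
    exact ⟨N, fun y hy => hN y (hST hy)⟩
  · rintro S T ⟨N, hN⟩ ⟨N', hN'⟩
    refine ⟨max N N', ?_⟩
    rintro y (hy | hy)
    · obtain ⟨n, s, hn, h⟩ := hN y hy
      exact ⟨n, s, by omega, h⟩
    · obtain ⟨n, s, hn, h⟩ := hN' y hy
      exact ⟨n, s, by omega, h⟩
  · intro y hy
    obtain ⟨m, t, hm, hc⟩ := hΩ.exists_wChain hf φ hy hx (half_pos hε)
    obtain ⟨δ, hδ, hd⟩ := Metric.continuousAt_iff.1 (hf.continuousAt (x := y)) (ε / 2)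
      (half_pos hε)
    refine ⟨Metric.ball y δ ∩ Ω, inter_mem (mem_nhdsWithin_of_mem_nhds
      (Metric.ball_mem_nhds y hδ)) self_mem_nhdsWithin, m, ?_⟩
    rintro y' ⟨hy', hyΩ⟩
    obtain ⟨s', h⟩ := hc.perturb_left hm hyΩ (half_pos hε).le (hd hy').le
    rw [add_halves] at h
    exact ⟨m, s', le_rfl, h⟩

end IsChainComponent

end Components

/-! ### Loops with prescribed mean -/

section Loops

variable {M : Type*} [MetricSpace M] {f : M → M} {φ : M → ℝ} {ε : ℝ} {S : Set M}

/-- Combining repetitions of a loop with mean almost at least `A` and a loop with mean almost at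
most `A` gives a loop with mean close to `A`. -/
theorem WChain.exists_mean_near {p q : ℕ} {s t A δ : ℝ} {x : M} (h : WChain f φ ε S p s x x)
    (h' : WChain f φ ε S q t x x) (hp : 0 < p) (hq : 0 < q) (hδ : 0 < δ)
    (hs : (A - δ) * p ≤ s) (ht : t ≤ (A + δ) * q) :
    ∃ n r, 0 < n ∧ WChain f φ ε S n r x x ∧ |r / n - A| ≤ δ := by
  have hp' : (0 : ℝ) < p := by exact_mod_cast hp
  have hq' : (0 : ℝ) < q := by exact_mod_cast hq
  have habs : ∀ {n : ℕ} {r : ℝ}, 0 < n → |r - A * n| ≤ δ * n → |r / n - A| ≤ δ := by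
    intro n r hn hr
    have hn' : (0 : ℝ) < n := by exact_mod_cast hn
    rw [show r / n - A = (r - A * n) / n by field_simp, abs_div, abs_of_pos hn', div_le_iff₀ hn']
    exact hr
  by_cases h1 : s ≤ (A + δ) * p
  · exact ⟨p, s, hp, h, habs hp (_root_.abs_le.2 ⟨by linarith, by linarith⟩)⟩
  by_cases h2 : (A - δ) * q ≤ t
  · exact ⟨q, t, hq, h', habs hq (_root_.abs_le.2 ⟨by linarith, by linarith⟩)⟩
  push Not at h1 h2
  have hu : 0 < s - A * p := by nlinarith
  have hv : 0 < A * q - t := by nlinarith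
  obtain ⟨n, hn⟩ := exists_nat_gt ((s - A * p) / δ)
  have hn0 : 0 < n := by
    have : (0 : ℝ) < n := (div_pos hu hδ).trans hn
    exact_mod_cast this
  rw [div_lt_iff₀ hδ] at hn
  -- Here `m` copies of the first loop just fail to outweigh the deficit of `n` copies of the
  -- second. The total deviation from `A` lies between `-(s - A * p)` and `0`, and `n` was chosen so
  -- that this is at most `δ` times the length.
  set m := ⌊n * (A * q - t) / (s - A * p)⌋₊ with hm
  have hm1 : m * (s - A * p) ≤ n * (A * q - t) := by
    rw [← le_div_iff₀ hu]
    exact Nat.floor_le (by positivity)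
  have hm2 : n * (A * q - t) < (m + 1) * (s - A * p) := by
    rw [← div_lt_iff₀ hu]
    exact Nat.lt_floor_add_one _
  have hnq : (n : ℝ) ≤ m * p + n * q := by
    have : (1 : ℝ) ≤ q := by exact_mod_cast hq
    have : 0 ≤ (m : ℝ) * p := by positivity
    nlinarith
  refine ⟨m * p + n * q, m * s + n * t, by positivity, (h.iterate m).trans (h'.iterate n),
    habs (by positivity) ?_⟩
  push_cast
  rw [_root_.abs_le]
  constructor <;> nlinarith

end Loops

section LoopsInComponent

variable {M : Type*} [MetricSpace M] [CompactSpace M] {f : M → M} {Ω : Set M} {φ : M → ℝ}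

/-- Closing long orbit segments up by chains of bounded length. -/
theorem IsChainComponent.exists_loop_ge (hf : Continuous f) (hφ : Continuous φ)
    (hΩ : IsChainComponent f Ω) {x : M} (hx : x ∈ Ω) {A : ℝ}
    (hA : ∀ n : ℕ, ∃ y ∈ Ω, n * A ≤ ∑ i ∈ Finset.range n, φ (f^[i] y)) {ε δ : ℝ} (hε : 0 < ε)
    (hδ : 0 < δ) : ∃ p s, 0 < p ∧ WChain f φ ε Ω p s x x ∧ (A - δ) * p ≤ s := by
  obtain ⟨C, hC⟩ := isCompact_univ.exists_bound_of_continuousOn hφ.continuousOn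
  replace hC : ∀ x, |φ x| ≤ C := fun x => hC x (mem_univ x)
  obtain ⟨N, hN⟩ := hΩ.exists_bound_from hf φ hx hε
  obtain ⟨N', hN'⟩ := hΩ.exists_bound_to hf φ hx hε
  have hC0 : 0 ≤ C := (abs_nonneg _).trans (hC x)
  -- `D` bounds the loss relative to `A` per connecting step; `n` is then taken so large that the
  -- loss on at most `N + N'` such steps is below `δ * n`.
  set D := C + |A| with hD
  have hD0 : 0 ≤ D := by positivity
  obtain ⟨n, hn⟩ := exists_nat_gt ((N + N') * D / δ)
  rw [div_lt_iff₀ hδ] at hn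
  have hn0 : 0 < n := by
    have : 0 ≤ (N + N') * D := by positivity
    have : (0 : ℝ) < n := by
      by_contra! h
      nlinarith
    exact_mod_cast this
  obtain ⟨y, hy, hyA⟩ := hA n
  have horb := WChain.orbit (φ := φ) (fun x hx => hΩ.map_mem hf hx) hε hy n
  obtain ⟨m, s, hm, hc⟩ := hN y hy
  obtain ⟨m', s', hm', hc'⟩ := hN' _ horb.mem_right
  refine ⟨m + n + m', _, by omega, (hc.trans horb).trans hc', ?_⟩
  have h1 := hc.abs_le hC
  have h2 := hc'.abs_le hC
  have h3 : (m : ℝ) ≤ N := by exact_mod_cast hm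
  have h4 : (m' : ℝ) ≤ N' := by exact_mod_cast hm'
  have h5 := neg_abs_le s
  have h6 := neg_abs_le s'
  have h7 : (m + m') * D ≤ (N + N') * D := mul_le_mul_of_nonneg_right (by linarith) hD0
  have h8 : (m + m') * A ≤ (m + m') * |A| :=
    mul_le_mul_of_nonneg_left (le_abs_self A) (by positivity)
  have h9 : 0 ≤ δ * m := by positivity
  have h10 : 0 ≤ δ * m' := by positivity
  push_cast
  rw [hD] at h7 hn
  nlinarith

/-- Closing up segments for `φ, A` and for `-φ, -A` gives a high loop and a low loop at the same
point, which can be mixed. -/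
theorem IsChainComponent.mem_averagingSpectrum (hf : Continuous f) (hφ : Continuous φ)
    (hΩ : IsChainComponent f Ω) {A : ℝ}
    (hA : ∀ n : ℕ, ∃ y ∈ Ω, n * A ≤ ∑ i ∈ Finset.range n, φ (f^[i] y))
    (hA' : ∀ n : ℕ, ∃ y ∈ Ω, ∑ i ∈ Finset.range n, φ (f^[i] y) ≤ n * A) :
    A ∈ averagingSpectrum f φ Ω := by
  obtain ⟨x, hx⟩ := hΩ.nonempty
  have hδ : ∀ k : ℕ, (0 : ℝ) < 1 / ((k : ℝ) + 1) := fun k => by positivity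
  have key : ∀ k : ℕ, ∃ (p : ℕ) (ξ : ℤ → M),
      IsPeriodicPseudotrajectory f (1 / ((k : ℝ) + 1)) p ξ ∧ (∀ n, ξ n ∈ Ω) ∧
      dist (periodAverage φ p ξ) A ≤ 1 / ((k : ℝ) + 1) := fun k => by
    obtain ⟨p, s, hp, hc, hs⟩ := hΩ.exists_loop_ge hf hφ hx hA (hδ k) (hδ k)
    obtain ⟨q, t, hq, hc', ht⟩ := hΩ.exists_loop_ge (φ := fun x => - φ x) hf hφ.neg hx
      (A := -A) (fun n => by
      obtain ⟨y, hy, h⟩ := hA' n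
      exact ⟨y, hy, by rw [Finset.sum_neg_distrib]; linarith⟩) (hδ k) (hδ k)
    obtain ⟨n, r, hn, hc, hr⟩ := hc.exists_mean_near hc'.neg hp hq (hδ k) hs (by linarith)
    obtain ⟨ξ, h1, h2, -, -, h3⟩ := hc.exists_periodic (.nil hx) (by omega)
    refine ⟨_, ξ, h1, h2, ?_⟩
    rw [h3, Real.dist_eq]
    simpa using hr
  choose p ξ h1 h2 h3 using key
  refine ⟨_, p, ξ, tendsto_one_div_add_atTop_nhds_zero_nat, fun k => ⟨h1 k, h2 k⟩, ?_⟩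
  exact tendsto_iff_dist_tendsto_zero.2 (squeeze_zero (fun _ => dist_nonneg) h3
    tendsto_one_div_add_atTop_nhds_zero_nat)

end LoopsInComponent

/-! ### Invariant measures and the spectrum -/

section Invariant

variable {M : Type*} [MetricSpace M] [CompactSpace M] [MeasurableSpace M] [BorelSpace M]
  {f : M → M} {Ω : Set M} {φ : M → ℝ}

theorem integrable_of_continuous {E : Type*} [NormedAddCommGroup E]
    {φ : M → E} (hφ : Continuous φ) (μ : Measure M)
    [IsFiniteMeasure μ] : Integrable φ μ :=
  hφ.integrable_of_hasCompactSupport (HasCompactSupport.of_compactSpace φ)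

/-- Turns concentration on a closed set into an equation for the integral of a continuous function,
which passes to weak limits. -/
theorem measure_compl_eq_zero_iff (hΩ : IsClosed Ω) (hne : Ω.Nonempty) (μ : Measure M)
    [IsFiniteMeasure μ] : μ Ωᶜ = 0 ↔ ∫ x, Metric.infDist x Ω ∂μ = 0 := by
  rw [integral_eq_zero_iff_of_nonneg (fun _ => Metric.infDist_nonneg)
    (integrable_of_continuous (Metric.continuous_infDist_pt Ω) μ)]
  change _ ↔ ∀ᵐ x ∂μ, Metric.infDist x Ω = 0
  simp_rw [← hΩ.mem_iff_infDist_zero hne]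
  rfl

omit [CompactSpace M] in
theorem measurePreserving_iff_integral (hf : Continuous f) (μ : Measure M) [IsFiniteMeasure μ] :
    MeasurePreserving f μ μ ↔
      ∀ ψ : BoundedContinuousFunction M ℝ, ∫ x, ψ (f x) ∂μ = ∫ x, ψ x ∂μ := by
  have hmap : ∀ ψ : BoundedContinuousFunction M ℝ, ∫ x, ψ (f x) ∂μ = ∫ x, ψ x ∂μ.map f :=
    fun ψ => (integral_map hf.aemeasurable ψ.continuous.aestronglyMeasurable).symm
  simp_rw [hmap]
  refine ⟨fun h ψ => by rw [h.map_eq], fun h => ⟨hf.measurable, ?_⟩⟩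
  exact ext_of_forall_integral_eq_of_IsFiniteMeasure h

theorem toFiniteMeasure_mem_invariantMeasures_iff (hf : Continuous f) (hΩ : IsClosed Ω)
    (hne : Ω.Nonempty) (μ : ProbabilityMeasure M) :
    μ.toFiniteMeasure ∈ invariantMeasures f Ω ↔
      (∀ ψ : BoundedContinuousFunction M ℝ,
        ∫ x, ψ (f x) ∂(μ : Measure M) = ∫ x, ψ x ∂(μ : Measure M)) ∧
      ∫ x, Metric.infDist x Ω ∂(μ : Measure M) = 0 := by
  rw [← measurePreserving_iff_integral hf, ← measure_compl_eq_zero_iff hΩ hne]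
  exact ⟨fun h => h.2, fun h => ⟨inferInstanceAs (IsProbabilityMeasure (μ : Measure M)), h⟩⟩

/-- A continuous function as a bounded continuous function. -/
noncomputable def boundedOfContinuous (φ : M → ℝ) (hφ : Continuous φ) :
    BoundedContinuousFunction M ℝ := BoundedContinuousFunction.mkOfCompact ⟨φ, hφ⟩

theorem continuous_integral (hφ : Continuous φ) :
    Continuous fun μ : ProbabilityMeasure M => ∫ x, φ x ∂(μ : Measure M) :=
  ProbabilityMeasure.continuous_integral_boundedContinuousFunction (boundedOfContinuous φ hφ)

theorem continuous_integral_finiteMeasure (hφ : Continuous φ) :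
    Continuous fun μ : FiniteMeasure M => ∫ x, φ x ∂(μ : Measure M) :=
  FiniteMeasure.continuous_integral_boundedContinuousFunction (boundedOfContinuous φ hφ)

theorem isCompact_invariantMeasures (hf : Continuous f) (hΩ : IsClosed Ω) (hne : Ω.Nonempty) :
    IsCompact (invariantMeasures f Ω) := by
  have himage : invariantMeasures f Ω = ProbabilityMeasure.toFiniteMeasure ''
      {μ : ProbabilityMeasure M | μ.toFiniteMeasure ∈ invariantMeasures f Ω} := by
    ext μ
    constructor
    · intro h
      exact ⟨⟨μ, h.1⟩, h, rfl⟩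
    · rintro ⟨ν, hν, rfl⟩
      exact hν
  rw [himage]
  refine IsCompact.image (IsClosed.isCompact ?_) ProbabilityMeasure.toFiniteMeasure_continuous
  simp_rw [toFiniteMeasure_mem_invariantMeasures_iff hf hΩ hne, ofPred_and, ofPred_forall]
  refine (isClosed_iInter fun ψ => ?_).inter ?_
  · exact isClosed_eq (continuous_integral (ψ.continuous.comp hf)) (continuous_integral ψ.continuous)
  · exact isClosed_eq (continuous_integral (Metric.continuous_infDist_pt Ω)) continuous_const

omit [MetricSpace M] [CompactSpace M] [BorelSpace M] in
theorem convex_invariantMeasures : Convex ℝ≥0 (invariantMeasures f Ω) := by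
  rintro μ ⟨hμ, hfμ, hμΩ⟩ ν ⟨hν, hfν, hνΩ⟩ a b - - hab
  refine ⟨⟨?_⟩, ?_, ?_⟩
  · rw [FiniteMeasure.toMeasure_add, FiniteMeasure.toMeasure_smul, FiniteMeasure.toMeasure_smul]
    simp only [Measure.add_apply, Measure.smul_apply, measure_univ]
    rw [ENNReal.smul_def, ENNReal.smul_def, smul_eq_mul, smul_eq_mul, mul_one, mul_one]
    exact_mod_cast hab
  · rw [FiniteMeasure.toMeasure_add, FiniteMeasure.toMeasure_smul, FiniteMeasure.toMeasure_smul]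
    refine ⟨hfμ.measurable, ?_⟩
    rw [Measure.map_add _ _ hfμ.measurable, Measure.map_smul, Measure.map_smul, hfμ.map_eq,
      hfν.map_eq]
  · rw [FiniteMeasure.toMeasure_add, FiniteMeasure.toMeasure_smul, FiniteMeasure.toMeasure_smul]
    simp [hμΩ, hνΩ]

theorem integral_convexComb (hφ : Continuous φ) (μ ν : FiniteMeasure M) (a b : ℝ≥0) :
    ∫ x, φ x ∂((a • μ + b • ν : FiniteMeasure M) : Measure M) =
      a * ∫ x, φ x ∂(μ : Measure M) + b * ∫ x, φ x ∂(ν : Measure M) := by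
  rw [FiniteMeasure.toMeasure_add, FiniteMeasure.toMeasure_smul, FiniteMeasure.toMeasure_smul,
    integral_add_measure (integrable_of_continuous hφ _) (integrable_of_continuous hφ _),
    integral_smul_nnreal_measure, integral_smul_nnreal_measure]
  rfl

theorem exists_image_integral_eq_Icc (hf : Continuous f) (hφ : Continuous φ) (hΩ : IsClosed Ω)
    (hne : Ω.Nonempty) (hinv : (invariantMeasures f Ω).Nonempty) : ∃ a b : ℝ, a ≤ b ∧
    (fun μ : FiniteMeasure M => ∫ x, φ x ∂(μ : Measure M)) '' invariantMeasures f Ω = Icc a b := by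
  have hconv : Convex ℝ
      ((fun μ : FiniteMeasure M => ∫ x, φ x ∂(μ : Measure M)) '' invariantMeasures f Ω) := by
    rintro _ ⟨μ, hμ, rfl⟩ _ ⟨ν, hν, rfl⟩ a b ha hb hab
    lift a to ℝ≥0 using ha
    lift b to ℝ≥0 using hb
    refine ⟨a • μ + b • ν, convex_invariantMeasures hμ hν a.2 b.2 (by exact_mod_cast hab), ?_⟩
    exact integral_convexComb hφ μ ν a b
  have hcomp := (isCompact_invariantMeasures hf hΩ hne).image (continuous_integral_finiteMeasure hφ)
  have hIcc := eq_Icc_of_connected_compact ⟨hinv.image _, hconv.isPreconnected⟩ hcomp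
  refine ⟨_, _, ?_, hIcc⟩
  rw [← nonempty_Icc, ← hIcc]
  exact hinv.image _

omit [CompactSpace M] in
/-- The uniform measure on one period of a periodic sequence. -/
theorem exists_periodMeasure {p : ℕ} (hp : 0 < p) (ξ : ℤ → M) :
    ∃ μ : ProbabilityMeasure M, ∀ ψ : M → ℝ, ∫ x, ψ x ∂(μ : Measure M) = periodAverage ψ p ξ := by
  have hp' : (p : ENNReal) ≠ 0 := by exact_mod_cast hp.ne'
  have hprob : IsProbabilityMeasure
      ((p : ENNReal)⁻¹ • ∑ i ∈ Finset.range p, Measure.dirac (ξ (i : ℤ))) := by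
    constructor
    simp [ENNReal.inv_mul_cancel hp']
  refine ⟨⟨_, hprob⟩, fun ψ => ?_⟩
  change ∫ x, ψ x ∂((p : ENNReal)⁻¹ • ∑ i ∈ Finset.range p, Measure.dirac (ξ (i : ℤ))) = _
  rw [integral_smul_measure, integral_finsetSum_measure fun i _ => integrable_dirac (by simp)]
  simp [periodAverage, div_eq_inv_mul]

omit [CompactSpace M] [MeasurableSpace M] [BorelSpace M] in
theorem IsPeriodicPseudotrajectory.sum_shift {p : ℕ} {ε : ℝ} {ξ : ℤ → M}
    (h : IsPeriodicPseudotrajectory f ε p ξ) (ψ : M → ℝ) :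
    ∑ i ∈ Finset.range p, ψ (ξ ((i : ℤ) + 1)) = ∑ i ∈ Finset.range p, ψ (ξ (i : ℤ)) := by
  have h1 := Finset.sum_range_succ' (fun i : ℕ => ψ (ξ (i : ℤ))) p
  have h2 := Finset.sum_range_succ (fun i : ℕ => ψ (ξ (i : ℤ))) p
  have h3 := h.2.2 0
  rw [zero_add] at h3
  rw [h3] at h2
  push_cast at h1 h2
  linarith

omit [CompactSpace M] [MeasurableSpace M] [BorelSpace M] in
-- By periodicity the mean of `ψ` may be taken over the shifted points, each within `ε` of the image
-- of its predecessor.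
theorem IsPeriodicPseudotrajectory.abs_periodAverage_comp_sub_le {p : ℕ} {ε : ℝ} {ξ : ℤ → M}
    (h : IsPeriodicPseudotrajectory f ε p ξ) {ψ : M → ℝ} {δ : ℝ}
    (hψ : ∀ x y, dist x y < ε → |ψ x - ψ y| ≤ δ) :
    |periodAverage (fun x => ψ (f x)) p ξ - periodAverage ψ p ξ| ≤ δ := by
  have hp : (0 : ℝ) < p := by exact_mod_cast h.1
  unfold periodAverage
  rw [← h.sum_shift ψ, ← sub_div, ← Finset.sum_sub_distrib, abs_div, abs_of_pos hp,
    div_le_iff₀ hp]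
  have hle : ∀ i ∈ Finset.range p, |ψ (f (ξ (i : ℤ))) - ψ (ξ ((i : ℤ) + 1))| ≤ δ :=
    fun i _ => hψ _ _ (h.2.1 i)
  refine (Finset.abs_sum_le_sum_abs _ _).trans ((Finset.sum_le_card_nsmul _ _ δ hle).trans ?_)
  simp [mul_comm]

/-- Weak limits of the uniform measures of finer and finer periodic trajectories of `Ω`. -/
theorem exists_invariantMeasure_of_mem_averagingSpectrum (hf : Continuous f) (hφ : Continuous φ)
    (hΩ : IsClosed Ω) (hne : Ω.Nonempty) {c : ℝ} (hc : c ∈ averagingSpectrum f φ Ω) :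
    ∃ μ ∈ invariantMeasures f Ω, ∫ x, φ x ∂(μ : Measure M) = c := by
  obtain ⟨ε, p, ξ, hε, hξ, hlim⟩ := hc
  choose ν hν using fun k => exists_periodMeasure (M := M) (hξ k).1.1 (ξ k)
  -- By compactness the measures converge along an ultrafilter finer than `atTop`, so no subsequence
  -- is needed.
  set U : Ultrafilter ℕ := hyperfilter ℕ with hU
  have hUtop : (U : Filter ℕ) ≤ atTop := Nat.hyperfilter_le_atTop
  obtain ⟨μ, -, hμ⟩ := isCompact_univ.ultrafilter_le_nhds (U.map ν) (by simp)
  have hμ' : Tendsto ν U (𝓝 μ) := hμ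
  have hint : ∀ {ψ : M → ℝ}, Continuous ψ →
      Tendsto (fun k => periodAverage ψ (p k) (ξ k)) U (𝓝 (∫ x, ψ x ∂(μ : Measure M))) := by
    intro ψ hψ
    have := ((continuous_integral hψ).tendsto μ).comp hμ'
    refine this.congr fun k => hν k ψ
  refine ⟨μ.toFiniteMeasure, (toFiniteMeasure_mem_invariantMeasures_iff hf hΩ hne μ).2 ⟨?_, ?_⟩,
    tendsto_nhds_unique (hint hφ) (hlim.mono_left hUtop)⟩
  · intro ψ
    have h1 := (hint (ψ.continuous.comp hf)).sub (hint ψ.continuous)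
    rw [← sub_eq_zero]
    refine tendsto_nhds_unique h1 (Tendsto.mono_left ?_ hUtop)
    rw [Metric.tendsto_nhds]
    intro δ hδ
    obtain ⟨η, hη, hψη⟩ := Metric.uniformContinuous_iff.1
      (CompactSpace.uniformContinuous_of_continuous ψ.continuous) (δ / 2) (half_pos hδ)
    filter_upwards [hε.eventually_lt_const hη] with k hk
    rw [Real.dist_eq, sub_zero]
    refine lt_of_le_of_lt ((hξ k).1.abs_periodAverage_comp_sub_le (δ := δ / 2) fun x y hxy => ?_)
      (half_lt_self hδ)
    exact (hψη (hxy.trans hk)).le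
  · refine tendsto_nhds_unique (hint (Metric.continuous_infDist_pt Ω)) ?_
    refine tendsto_const_nhds.congr fun k => ?_
    simp [periodAverage, Metric.infDist_zero_of_mem ((hξ k).2 _)]

omit [MeasurableSpace M] [BorelSpace M] in
-- Together with the weak limit argument this provides an invariant measure on `Ω`.
theorem IsChainComponent.averagingSpectrum_nonempty (hf : Continuous f) (hφ : Continuous φ)
    (hΩ : IsChainComponent f Ω) : (averagingSpectrum f φ Ω).Nonempty := by
  obtain ⟨x, hx⟩ := hΩ.nonempty
  obtain ⟨C, hC⟩ := isCompact_univ.exists_bound_of_continuousOn hφ.continuousOn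
  have hδ : ∀ k : ℕ, (0 : ℝ) < 1 / ((k : ℝ) + 1) := fun k => by positivity
  have key : ∀ k : ℕ, ∃ (p : ℕ) (ξ : ℤ → M),
      IsPeriodicPseudotrajectory f (1 / ((k : ℝ) + 1)) p ξ ∧ (∀ n, ξ n ∈ Ω) ∧
      periodAverage φ p ξ ∈ Icc (-C) C := fun k => by
    obtain ⟨n, s, hn, hc⟩ := hΩ.exists_wChain hf φ hx hx (hδ k)
    obtain ⟨ξ, h1, h2, -, -, h3⟩ := hc.exists_periodic (.nil hx) (by omega)
    refine ⟨_, ξ, h1, h2, ?_⟩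
    have hn' : (0 : ℝ) < n := by exact_mod_cast hn
    rw [h3, mem_Icc, ← abs_le]
    simp only [add_zero]
    rw [abs_div, abs_of_pos hn', div_le_iff₀ hn', mul_comm]
    exact hc.abs_le fun x => hC x (mem_univ x)
  choose p ξ h1 h2 h3 using key
  obtain ⟨c, -, θ, hθ, hc⟩ := isCompact_Icc.tendsto_subseq h3
  exact ⟨c, _, fun k => p (θ k), fun k => ξ (θ k),
    tendsto_one_div_add_atTop_nhds_zero_nat.comp hθ.tendsto_atTop,
    fun k => ⟨h1 _, h2 _⟩, hc⟩

theorem integral_sum_iterate (hφ : Continuous φ) {μ : Measure M} [IsProbabilityMeasure μ]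
    (hf : Continuous f) (hμ : MeasurePreserving f μ μ) (n : ℕ) :
    Integrable (fun x => ∑ i ∈ Finset.range n, φ (f^[i] x)) μ ∧
      ∫ x, ∑ i ∈ Finset.range n, φ (f^[i] x) ∂μ = n * ∫ x, φ x ∂μ := by
  have h1 : ∀ i, Integrable (fun x => φ (f^[i] x)) μ := fun i =>
    integrable_of_continuous (hφ.comp (hf.iterate i)) μ
  refine ⟨integrable_finsetSum _ fun i _ => h1 i, ?_⟩
  rw [integral_finsetSum _ fun i _ => h1 i]
  have h2 : ∀ i, ∫ x, φ (f^[i] x) ∂μ = ∫ x, φ x ∂μ := fun i => by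
    conv_rhs => rw [← (hμ.iterate i).map_eq]
    exact (integral_map (hμ.iterate i).aemeasurable hφ.aestronglyMeasurable).symm
  simp [h2]

/-- An integrable function is at most its mean somewhere off a null set and at least its mean
somewhere else; this is applied to the Birkhoff sums, off the null set `Ωᶜ`. -/
theorem IsChainComponent.averagingSpectrum_eq_image (hf : Continuous f) (hφ : Continuous φ)
    (hΩ : IsChainComponent f Ω) : averagingSpectrum f φ Ω =
      (fun μ : FiniteMeasure M => ∫ x, φ x ∂(μ : Measure M)) '' invariantMeasures f Ω := by
  refine Subset.antisymm (fun c hc => exists_invariantMeasure_of_mem_averagingSpectrum hf hφ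
    (hΩ.isClosed hf) hΩ.nonempty hc) ?_
  rintro _ ⟨μ, ⟨hμ, hfμ, hμΩ⟩, rfl⟩
  refine hΩ.mem_averagingSpectrum hf hφ (fun n => ?_) fun n => ?_
  · obtain ⟨hi, heq⟩ := integral_sum_iterate hφ hf hfμ n
    obtain ⟨x, hx, h⟩ := exists_notMem_null_integral_le hi hμΩ
    exact ⟨x, not_not.1 hx, by rwa [← heq]⟩
  · obtain ⟨hi, heq⟩ := integral_sum_iterate hφ hf hfμ n
    obtain ⟨x, hx, h⟩ := exists_notMem_null_le_integral hi hμΩ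
    exact ⟨x, not_not.1 hx, by rwa [← heq]⟩

end Invariant

/-! ### Level sets and their extreme points -/

section Level

variable {M : Type*} [MetricSpace M] [CompactSpace M] [MeasurableSpace M] [BorelSpace M]
  {f : M → M} {Ω : Set M} {φ : M → ℝ} {c : ℝ}

theorem convex_levelMeasures (hφ : Continuous φ) : Convex ℝ≥0 (levelMeasures f φ Ω c) := by
  rintro μ ⟨hμ, hμc⟩ ν ⟨hν, hνc⟩ a b ha hb hab
  refine ⟨convex_invariantMeasures hμ hν ha hb hab, ?_⟩
  rw [integral_convexComb hφ, hμc, hνc, ← add_mul]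
  have : (a : ℝ) + b = 1 := by exact_mod_cast hab
  rw [this, one_mul]

theorem isCompact_levelMeasures (hf : Continuous f) (hφ : Continuous φ) (hΩ : IsClosed Ω)
    (hne : Ω.Nonempty) : IsCompact (levelMeasures f φ Ω c) :=
  (isCompact_invariantMeasures hf hΩ hne).inter_right
    (isClosed_eq (continuous_integral_finiteMeasure hφ) continuous_const)

omit [MetricSpace M] [CompactSpace M] [BorelSpace M] in
-- A part of a convex decomposition of an ergodic measure is invariant and absolutely continuous
-- with respect to it, hence equal to it.
theorem mem_extremePoints_levelMeasures_of_ergodic {μ : FiniteMeasure M}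
    (hμ : μ ∈ levelMeasures f φ Ω c) (herg : Ergodic f (μ : Measure M)) :
    μ ∈ extremePoints ℝ≥0 (levelMeasures f φ Ω c) := by
  rw [mem_extremePoints_iff_left]
  refine ⟨hμ, ?_⟩
  rintro ν₁ hν₁ ν₂ hν₂ ⟨a, b, ha, hb, hab, rfl⟩
  have h1 := hν₁.1.1
  have h2 := hμ.1.1
  refine FiniteMeasure.toMeasure_injective (herg.eq_of_absolutelyContinuous hν₁.1.2.1 ?_)
  rw [FiniteMeasure.toMeasure_add, FiniteMeasure.toMeasure_smul]
  exact (Measure.absolutelyContinuous_smul (by exact_mod_cast ha.ne')).add_right _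

omit [MetricSpace M] [CompactSpace M] [BorelSpace M] in
/-- Conditioning an invariant measure on an invariant set. -/
theorem exists_cond_mem_invariantMeasures {μ : FiniteMeasure M} (hμ : μ ∈ invariantMeasures f Ω)
    {s : Set M} (hs : MeasurableSet s) (hfs : f ⁻¹' s = s) (h0 : (μ : Measure M) s ≠ 0) :
    ∃ ν ∈ invariantMeasures f Ω, (ν : Measure M) = ProbabilityTheory.cond (μ : Measure M) s := by
  have hprob := ProbabilityTheory.cond_isProbabilityMeasure h0
  refine ⟨⟨ProbabilityTheory.cond (μ : Measure M) s, inferInstance⟩, ⟨hprob, ?_, ?_⟩, rfl⟩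
  · refine MeasurePreserving.smul_measure ?_ _
    have := hμ.2.1.restrict_preimage hs
    rwa [hfs] at this
  · exact ProbabilityTheory.cond_absolutelyContinuous hμ.2.2

/-- An invariant set that is neither null nor conull splits `μ` into two conditional measures. As
`c` is an extreme value, both lie in the level set, against extremality. -/
theorem ergodic_of_mem_extremePoints_levelMeasures (hφ : Continuous φ)
    (hc : (∀ ν ∈ invariantMeasures f Ω, ∫ x, φ x ∂(ν : Measure M) ≤ c) ∨
      ∀ ν ∈ invariantMeasures f Ω, c ≤ ∫ x, φ x ∂(ν : Measure M))
    {μ : FiniteMeasure M} (h : μ ∈ extremePoints ℝ≥0 (levelMeasures f φ Ω c)) :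
    Ergodic f (μ : Measure M) := by
  have hμ := h.1.1
  have hprob := hμ.1
  refine ⟨hμ.2.1, ⟨fun s hs hfs => ?_⟩⟩
  by_contra H
  obtain ⟨h0, h0'⟩ : (μ : Measure M) s ≠ 0 ∧ (μ : Measure M) sᶜ ≠ 0 := by
    simpa [eventuallyConst_set, ae_iff, and_comm] using! H
  obtain ⟨ν, hν, hνs⟩ := exists_cond_mem_invariantMeasures hμ hs hfs h0
  obtain ⟨ν', hν', hνs'⟩ := exists_cond_mem_invariantMeasures hμ hs.compl
    (by rw [preimage_compl, hfs]) h0'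
  have ha : 0 < μ s := by
    rw [pos_iff_ne_zero, Ne, FiniteMeasure.null_iff_toMeasure_null]
    exact h0
  have hb : 0 < μ sᶜ := by
    rw [pos_iff_ne_zero, Ne, FiniteMeasure.null_iff_toMeasure_null]
    exact h0'
  have hab : μ s + μ sᶜ = 1 := by
    rw [← ENNReal.coe_inj, ENNReal.coe_add, FiniteMeasure.ennreal_coeFn_eq_coeFn_toMeasure,
      FiniteMeasure.ennreal_coeFn_eq_coeFn_toMeasure, measure_add_measure_compl hs, measure_univ]
    rfl
  have hdec : μ s • ν + μ sᶜ • ν' = μ := by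
    apply FiniteMeasure.toMeasure_injective
    rw [FiniteMeasure.toMeasure_add, FiniteMeasure.toMeasure_smul, FiniteMeasure.toMeasure_smul,
      hνs, hνs']
    ext t ht
    simp only [Measure.add_apply, Measure.smul_apply, ENNReal.smul_def, smul_eq_mul,
      FiniteMeasure.ennreal_coeFn_eq_coeFn_toMeasure]
    rw [ProbabilityTheory.cond_apply hs, ProbabilityTheory.cond_apply hs.compl, ← mul_assoc,
      ← mul_assoc, ENNReal.mul_inv_cancel h0 (measure_ne_top _ _),
      ENNReal.mul_inv_cancel h0' (measure_ne_top _ _), one_mul, one_mul, inter_comm,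
      inter_comm sᶜ, ← sdiff_eq, measure_inter_add_sdiff t hs]
  have hint := integral_convexComb hφ ν ν' (μ s) (μ sᶜ)
  rw [hdec, h.1.2] at hint
  have ha' : (0 : ℝ) < μ s := ha
  have hb' : (0 : ℝ) < μ sᶜ := hb
  have hab' : (μ s : ℝ) + μ sᶜ = 1 := by exact_mod_cast hab
  have hνc : ∫ x, φ x ∂(ν : Measure M) = c ∧ ∫ x, φ x ∂(ν' : Measure M) = c := by
    -- Both terms have the same sign by `hc`, so both vanish.
    have hsum : (μ s : ℝ) * (∫ x, φ x ∂(ν : Measure M) - c) +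
        (μ sᶜ : ℝ) * (∫ x, φ x ∂(ν' : Measure M) - c) = 0 := by
      have : (μ s : ℝ) * c + μ sᶜ * c = c := by rw [← add_mul, hab', one_mul]
      linarith
    rcases hc with hc | hc
    · have h1 := hc ν hν
      have h2 := hc ν' hν'
      constructor <;> nlinarith
    · have h1 := hc ν hν
      have h2 := hc ν' hν'
      constructor <;> nlinarith
  have heq : ν = μ := h.2 ⟨hν, hνc.1⟩ ⟨hν', hνc.2⟩ ⟨_, _, ha, hb, hab, hdec⟩
  rw [← heq, hνs, ProbabilityTheory.cond_apply hs] at h0'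
  simp at h0'

theorem extremePoints_levelMeasures (hφ : Continuous φ)
    (hc : (∀ ν ∈ invariantMeasures f Ω, ∫ x, φ x ∂(ν : Measure M) ≤ c) ∨
      ∀ ν ∈ invariantMeasures f Ω, c ≤ ∫ x, φ x ∂(ν : Measure M)) :
    extremePoints ℝ≥0 (levelMeasures f φ Ω c) =
      {μ | μ ∈ invariantMeasures f Ω ∧ Ergodic f (μ : Measure M) ∧
        ∫ x, φ x ∂(μ : Measure M) = c} := by
  ext μ
  constructor
  · intro h
    exact ⟨h.1.1, ergodic_of_mem_extremePoints_levelMeasures hφ hc h, h.1.2⟩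
  · rintro ⟨h1, h2, h3⟩
    exact mem_extremePoints_levelMeasures_of_ergodic ⟨h1, h3⟩ h2

end Level

/-! ### Birkhoff averages and ergodic disintegration -/

section Ergodic

open ProbabilityTheory

variable {X : Type*} [MeasurableSpace X] {f : X → X} {μ : Measure X}

/-- The Birkhoff averages of the Koopman operator are the classes of the Birkhoff averages. -/
theorem coeFn_birkhoffAverage_compMeasurePreserving (hf : MeasurePreserving f μ μ) {g : X → ℝ}
    (hg : MemLp g 2 μ) (n : ℕ) :
    (birkhoffAverage ℝ (Lp.compMeasurePreservingₗᵢ ℝ f hf : Lp ℝ 2 μ →ₗᵢ[ℝ] Lp ℝ 2 μ) id n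
      (hg.toLp g) : Lp ℝ 2 μ) =ᵐ[μ] birkhoffAverage ℝ f g n := by
  have hit : ∀ i, ((Lp.compMeasurePreservingₗᵢ ℝ f hf : Lp ℝ 2 μ →ₗᵢ[ℝ] Lp ℝ 2 μ)^[i]
      (hg.toLp g) : Lp ℝ 2 μ) =ᵐ[μ] g ∘ f^[i] := by
    intro i
    induction i with
    | zero => simpa using hg.coeFn_toLp
    | succ i ih =>
      rw [Function.iterate_succ_apply', Function.iterate_succ, ← Function.comp_assoc]
      exact (Lp.coeFn_compMeasurePreserving _ hf).trans (hf.quasiMeasurePreserving.ae_eq ih)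
  have hsum : ∀ n, (birkhoffSum (Lp.compMeasurePreservingₗᵢ ℝ f hf : Lp ℝ 2 μ →ₗᵢ[ℝ] Lp ℝ 2 μ) id n
      (hg.toLp g) : Lp ℝ 2 μ) =ᵐ[μ] birkhoffSum f g n := by
    intro n
    induction n with
    | zero => simpa using Lp.coeFn_zero ℝ 2 μ
    | succ n ih =>
      rw [birkhoffSum_succ]
      filter_upwards [Lp.coeFn_add (birkhoffSum (Lp.compMeasurePreservingₗᵢ ℝ f hf) id n
        (hg.toLp g)) (id ((Lp.compMeasurePreservingₗᵢ ℝ f hf)^[n] (hg.toLp g))), ih, hit n]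
        with x h1 h2 h3
      rw [h1, birkhoffSum_succ, Pi.add_apply, h2, id, h3]
      rfl
  unfold birkhoffAverage
  filter_upwards [Lp.coeFn_smul ((n : ℝ)⁻¹) (birkhoffSum (Lp.compMeasurePreservingₗᵢ ℝ f hf) id n
    (hg.toLp g)), hsum n] with x h1 h2
  rw [h1, Pi.smul_apply, h2]

/-- Along a subsequence the Birkhoff averages of a square integrable function converge almost
everywhere. -/
theorem exists_seq_tendsto_birkhoffAverage (hf : MeasurePreserving f μ μ) {g : X → ℝ}
    (hg : MemLp g 2 μ) : ∃ k : ℕ → ℕ, StrictMono k ∧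
      ∀ᵐ x ∂μ, ∃ l, Tendsto (fun j => birkhoffAverage ℝ f g (k j) x) atTop (𝓝 l) := by
  set T : Lp ℝ 2 μ →ₗᵢ[ℝ] Lp ℝ 2 μ := Lp.compMeasurePreservingₗᵢ ℝ f hf
  -- Mean ergodic theorem for the Koopman isometry; $L^2$ convergence gives convergence in measure,
  -- hence almost everywhere along a subsequence.
  have h := T.toContinuousLinearMap.tendsto_birkhoffAverage_orthogonalProjection
    T.norm_toContinuousLinearMap_le (hg.toLp g)
  obtain ⟨k, hk, hlim⟩ := (tendstoInMeasure_of_tendsto_Lp h).exists_seq_tendsto_ae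
  refine ⟨k, hk, ?_⟩
  have hall : ∀ᵐ x ∂μ, ∀ n : ℕ, (birkhoffAverage ℝ T id n (hg.toLp g) : Lp ℝ 2 μ) x =
      birkhoffAverage ℝ f g n x :=
    ae_all_iff.2 fun n => coeFn_birkhoffAverage_compMeasurePreserving hf hg n
  filter_upwards [hlim, hall] with x h1 h2
  refine ⟨_, h1.congr fun j => ?_⟩
  exact h2 (k j)

theorem measurable_birkhoffAverage (hf : Measurable f) {g : X → ℝ} (hg : Measurable g) (n : ℕ) :
    Measurable (birkhoffAverage ℝ f g n) := by
  have hsum : Measurable (birkhoffSum f g n) :=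
    Finset.measurable_fun_sum _ fun i _ => hg.comp (hf.iterate i)
  exact hsum.const_smul ((n : ℝ)⁻¹)

/-- The almost everywhere limit can be chosen strictly invariant. -/
theorem exists_invariant_limit (hf : MeasurePreserving f μ μ) [IsFiniteMeasure μ] {g : X → ℝ}
    (hg : Measurable g) {C : ℝ} (hC : ∀ x, ‖g x‖ ≤ C) :
    ∃ (k : ℕ → ℕ) (h : X → ℝ), StrictMono k ∧ Measurable h ∧ (∀ x, h (f x) = h x) ∧
      ∀ᵐ x ∂μ, Tendsto (fun j => birkhoffAverage ℝ f g (k j) x) atTop (𝓝 (h x)) := by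
  obtain ⟨k, hk, hlim⟩ := exists_seq_tendsto_birkhoffAverage hf
    (MemLp.of_bound (p := 2) hg.aestronglyMeasurable C (ae_of_all μ hC))
  have hmeas := fun j => measurable_birkhoffAverage hf.measurable hg (k j)
  set S := {x | ∃ l, Tendsto (fun j => birkhoffAverage ℝ f g (k j) x) atTop (𝓝 l)} with hS
  have hSm : MeasurableSet S := measurableSet_exists_tendsto hmeas
  have hdiff : ∀ x, Tendsto (fun j => birkhoffAverage ℝ f g (k j) (f x) -
      birkhoffAverage ℝ f g (k j) x) atTop (𝓝 0) := fun x => by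
    refine (tendsto_birkhoffAverage_apply_sub_birkhoffAverage ℝ ?_).comp hk.tendsto_atTop
    refine (Metric.isBounded_closedBall (x := (0 : ℝ)) (r := C)).subset ?_
    rintro _ ⟨n, rfl⟩
    simpa using hC (f^[n] x)
  -- For bounded `g` the averages at `x` and `f x` differ by a null sequence at every point, so the
  -- convergence set and the limit are strictly invariant, not merely up to null sets.
  have hiff : ∀ x l, Tendsto (fun j => birkhoffAverage ℝ f g (k j) (f x)) atTop (𝓝 l) ↔
      Tendsto (fun j => birkhoffAverage ℝ f g (k j) x) atTop (𝓝 l) := fun x l => by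
    constructor
    · intro h
      simpa using h.sub (hdiff x)
    · intro h
      simpa using h.add (hdiff x)
  refine ⟨k, S.indicator fun x => limsup (fun j => birkhoffAverage ℝ f g (k j) x) atTop, hk,
    (Measurable.limsup hmeas).indicator hSm, fun x => ?_, ?_⟩
  · by_cases hx : x ∈ S
    · obtain ⟨l, hl⟩ := hx
      have hl' := (hiff x l).2 hl
      rw [indicator_of_mem (show x ∈ S from ⟨l, hl⟩), indicator_of_mem (show f x ∈ S from ⟨l, hl'⟩),
        hl.limsup_eq, hl'.limsup_eq]
    · have hx' : f x ∉ S := fun ⟨l, hl⟩ => hx ⟨l, (hiff x l).1 hl⟩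
      rw [indicator_of_notMem hx, indicator_of_notMem hx']
  · filter_upwards [hlim] with x hx
    rw [indicator_of_mem (show x ∈ S from hx)]
    obtain ⟨l, hl⟩ := hx
    rwa [hl.limsup_eq]

theorem setIntegral_birkhoffAverage (hf : MeasurePreserving f μ μ) {g : X → ℝ}
    (hg : Integrable g μ) {s : Set X} (hs : MeasurableSet s) (hfs : f ⁻¹' s = s) {n : ℕ}
    (hn : 0 < n) : ∫ x in s, birkhoffAverage ℝ f g n x ∂μ = ∫ x in s, g x ∂μ := by
  have hfr : MeasurePreserving f (μ.restrict s) (μ.restrict s) := by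
    have := hf.restrict_preimage hs
    rwa [hfs] at this
  have hgr : Integrable g (μ.restrict s) := hg.restrict
  have hcomp : ∀ i, Integrable (fun x => g (f^[i] x)) (μ.restrict s) := fun i =>
    (hfr.iterate i).integrable_comp_of_integrable hgr
  have hint : ∀ i, ∫ x in s, g (f^[i] x) ∂μ = ∫ x in s, g x ∂μ := fun i => by
    conv_rhs => rw [← (hfr.iterate i).map_eq]
    refine (integral_map (hfr.iterate i).aemeasurable ?_).symm
    rw [(hfr.iterate i).map_eq]
    exact hgr.aestronglyMeasurable
  unfold birkhoffAverage birkhoffSum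
  rw [integral_smul, integral_finsetSum _ fun i _ => hcomp i]
  have hn' : (n : ℝ) ≠ 0 := by exact_mod_cast hn.ne'
  simp [hint, hn']

omit [MeasurableSpace X] in
theorem norm_birkhoffAverage_le {g : X → ℝ} {C : ℝ} (hC : ∀ x, ‖g x‖ ≤ C) (n : ℕ) (x : X) :
    ‖birkhoffAverage ℝ f g n x‖ ≤ C := by
  have hC0 : 0 ≤ C := (norm_nonneg _).trans (hC x)
  rcases Nat.eq_zero_or_pos n with rfl | hn
  · simpa using hC0
  have hn' : (0 : ℝ) < n := by exact_mod_cast hn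
  unfold birkhoffAverage birkhoffSum
  rw [norm_smul, norm_inv, Real.norm_natCast, inv_mul_le_iff₀ hn']
  refine (norm_sum_le _ _).trans ((Finset.sum_le_card_nsmul _ _ C fun i _ => hC _).trans ?_)
  simp

/-- An invariant probability measure is ergodic if the Birkhoff averages of the indicators of a
generating π-system converge to constants along subsequences. -/
theorem ergodic_of_tendsto_birkhoffAverage [IsProbabilityMeasure μ] (hf : MeasurePreserving f μ μ)
    {𝒞 : Set (Set X)} (hgen : ‹MeasurableSpace X› = MeasurableSpace.generateFrom 𝒞)
    (hpi : IsPiSystem 𝒞)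
    (hlim : ∀ B ∈ 𝒞, ∃ (k : ℕ → ℕ) (l : ℝ), StrictMono k ∧ ∀ᵐ x ∂μ,
      Tendsto (fun j => birkhoffAverage ℝ f (B.indicator fun _ => (1 : ℝ)) (k j) x) atTop (𝓝 l)) :
    Ergodic f μ := by
  have hmeas : ∀ B ∈ 𝒞, MeasurableSet B := fun B hB => by
    rw [hgen]
    exact MeasurableSpace.measurableSet_generateFrom hB
  refine ⟨hf, ⟨fun s hs hfs => ?_⟩⟩
  -- Integrating the averages over an invariant `t` gives `μ.real (B ∩ t) = μ.real t * l`; the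
  -- choices `t = univ` and `t = s` show that `s` is independent of every `B`.
  have hprod : ∀ B ∈ 𝒞, μ.real (B ∩ s) = μ.real s * μ.real B := by
    intro B hB
    obtain ⟨k, l, hk, hl⟩ := hlim B hB
    have hgm : Measurable (B.indicator fun _ => (1 : ℝ)) :=
      measurable_const.indicator (hmeas B hB)
    have hbd : ∀ x, ‖B.indicator (fun _ => (1 : ℝ)) x‖ ≤ 1 := fun x => by
      by_cases hx : x ∈ B <;> simp [hx]
    have hgi : Integrable (B.indicator fun _ => (1 : ℝ)) μ :=
      (integrable_const 1).indicator (hmeas B hB)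
    have key : ∀ t : Set X, MeasurableSet t → f ⁻¹' t = t → μ.real (B ∩ t) = μ.real t * l := by
      intro t ht hft
      have h1 : Tendsto (fun j => ∫ x in t, birkhoffAverage ℝ f (B.indicator fun _ => (1 : ℝ))
          (k j) x ∂μ) atTop (𝓝 (∫ x in t, l ∂μ)) := by
        refine tendsto_integral_of_dominated_convergence (fun _ => 1)
          (fun j => (measurable_birkhoffAverage hf.measurable hgm _).aestronglyMeasurable)
          (integrable_const 1) (fun j => ae_of_all _ fun x => norm_birkhoffAverage_le hbd _ _) ?_
        exact ae_restrict_of_ae hl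
      have h2 : ∀ᶠ j in atTop, ∫ x in t, birkhoffAverage ℝ f (B.indicator fun _ => (1 : ℝ))
          (k j) x ∂μ = μ.real (B ∩ t) := by
        filter_upwards [hk.tendsto_atTop.eventually_gt_atTop 0] with j hj
        rw [setIntegral_birkhoffAverage hf hgi ht hft hj, integral_indicator (hmeas B hB),
          Measure.restrict_restrict (hmeas B hB)]
        simp
      have h3 := tendsto_nhds_unique (tendsto_const_nhds.congr' (h2.mono fun _ h => h.symm)) h1
      rw [h3]
      simp
    have huniv := key univ .univ rfl
    rw [inter_univ, probReal_univ, one_mul] at huniv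
    rw [key s hs hfs, huniv]
  have hext : μ.restrict s = μ s • μ := by
    refine ext_of_generate_finite 𝒞 hgen hpi (fun B hB => ?_) ?_
    · rw [Measure.restrict_apply (hmeas B hB), Measure.smul_apply, smul_eq_mul]
      rw [← ENNReal.toReal_eq_toReal_iff' (by finiteness) (by finiteness), ENNReal.toReal_mul]
      exact hprod B hB
    · simp
  -- Independence extends from the π-system to `s` itself, which forces measure `0` or `1`.
  have hss : μ s = μ s * μ s := by
    have := congrArg (fun ν => ν s) hext
    simpa using this
  rw [eventuallyConst_set']
  have hor : μ s = 0 ∨ μ s = 1 := by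
    by_cases h0 : μ s = 0
    · exact Or.inl h0
    · refine Or.inr ?_
      have := (ENNReal.mul_right_inj h0 (measure_ne_top μ s)).1 (hss.symm.trans (mul_one _).symm)
      exact this
  rcases hor with h | h
  · left
    exact ae_eq_empty.2 h
  · right
    rw [ae_eq_univ]
    exact (prob_compl_eq_zero_iff hs).2 h

/-- A countable π-system generating the σ-algebra. -/
theorem exists_countable_generating_piSystem (X : Type*) [m : MeasurableSpace X]
    [MeasurableSpace.CountablyGenerated X] :
    ∃ B : ℕ → Set X, m = MeasurableSpace.generateFrom (range B) ∧ IsPiSystem (range B) := by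
  set 𝒜 := generateSetAlgebra (MeasurableSpace.countableGeneratingSet X)
  have halg : IsSetAlgebra 𝒜 := isSetAlgebra_generateSetAlgebra
  have hcount : 𝒜.Countable :=
    countable_generateSetAlgebra MeasurableSpace.countable_countableGeneratingSet
  obtain ⟨B, hB⟩ := hcount.exists_eq_range ⟨∅, halg.empty_mem⟩
  refine ⟨B, ?_, ?_⟩
  · rw [← hB, generateFrom_generateSetAlgebra_eq,
      MeasurableSpace.generateFrom_countableGeneratingSet]
  · rw [← hB]
    exact fun s hs t ht _ => halg.inter_mem hs ht

/-- Ergodic decomposition of an invariant probability measure, by disintegration along an invariant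
map with values in a sequence space. -/
theorem exists_ergodic_disintegration [StandardBorelSpace X] [Nonempty X]
    [IsProbabilityMeasure μ] (hf : MeasurePreserving f μ μ) :
    ∃ (F : X → ℕ → ℝ) (κ : Kernel (ℕ → ℝ) X), Measurable F ∧ (∀ x, F (f x) = F x) ∧
      IsMarkovKernel κ ∧ κ ∘ₘ (μ.map F) = μ ∧
      ∀ᵐ α ∂μ.map F, Ergodic f (κ α) ∧ ∀ᵐ x ∂κ α, F x = α := by
  obtain ⟨B, hgen, hpi⟩ := exists_countable_generating_piSystem X
  have hBm : ∀ n, MeasurableSet (B n) := fun n => by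
    rw [hgen]
    exact MeasurableSpace.measurableSet_generateFrom (mem_range_self n)
  have hlim : ∀ n, ∃ (k : ℕ → ℕ) (h : X → ℝ), StrictMono k ∧ Measurable h ∧
      (∀ x, h (f x) = h x) ∧ ∀ᵐ x ∂μ, Tendsto (fun j =>
        birkhoffAverage ℝ f ((B n).indicator fun _ => (1 : ℝ)) (k j) x) atTop (𝓝 (h x)) :=
    fun n => exists_invariant_limit hf (measurable_const.indicator (hBm n)) (C := 1) fun x => by
      by_cases hx : x ∈ B n <;> simp [hx]
  choose k h hk hm hinv hae using hlim
  set F : X → ℕ → ℝ := fun x n => h n x with hF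
  have hFm : Measurable F := measurable_pi_lambda _ hm
  have hFf : ∀ x, F (f x) = F x := fun x => funext fun n => hinv n x
  set κ := condDistrib id F μ with hκ
  have hcomp : κ ∘ₘ (μ.map F) = μ := by
    rw [hκ, condDistrib_comp_map hFm.aemeasurable aemeasurable_id, Measure.map_id]
  refine ⟨F, κ, hFm, hFf, inferInstance, hcomp, ?_⟩
  have hdis : (μ.map F) ⊗ₘ κ = μ.map fun x => (F x, id x) :=
    compProd_map_condDistrib aemeasurable_id
  have hfib : ∀ᵐ α ∂μ.map F, ∀ᵐ x ∂κ α, F x = α := by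
    refine Measure.ae_ae_of_ae_compProd (p := fun q : (ℕ → ℝ) × X => F q.2 = q.1) ?_
    have hgraph : MeasurableSet {q : (ℕ → ℝ) × X | F q.2 = q.1} :=
      measurableSet_eq_fun (hFm.comp measurable_snd) measurable_fst
    rw [hdis, ae_map_iff (hFm.prodMk measurable_id).aemeasurable hgraph]
    exact ae_of_all _ fun x => rfl
  -- Since `F ∘ f = F` and `f` preserves `μ`, the pairs `(F x, f x)` and `(F x, x)` have the same
  -- law; uniqueness of disintegration makes almost every fibre measure invariant.
  have hmap : ∀ᵐ α ∂μ.map F, κ α = (κ α).map f := by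
    have h1 := condDistrib_comp (mβ := MeasurableSpace.pi) (μ := μ) F aemeasurable_id
      hf.measurable
    have h2 : condDistrib (f ∘ id) F μ =ᵐ[μ.map F] κ := by
      refine condDistrib_ae_eq_of_measure_eq_compProd F
        (hf.measurable.comp measurable_id).aemeasurable ?_
      rw [hdis]
      conv_rhs => rw [← hf.map_eq]
      rw [Measure.map_map (hFm.prodMk measurable_id) hf.measurable]
      congr 1
      ext1 x
      simp [hFf]
    filter_upwards [h1, h2] with α h1 h2
    rw [← Kernel.map_apply _ hf.measurable, ← h1, h2]
  have hconv : ∀ᵐ α ∂μ.map F, ∀ n, ∀ᵐ x ∂κ α, Tendsto (fun j =>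
        birkhoffAverage ℝ f ((B n).indicator fun _ => (1 : ℝ)) (k n j) x) atTop (𝓝 (h n x)) := by
    rw [ae_all_iff]
    intro n
    refine Measure.ae_ae_of_ae_comp ?_
    rw [hcomp]
    exact hae n
  filter_upwards [hfib, hmap, hconv] with α h1 h2 h3
  refine ⟨ergodic_of_tendsto_birkhoffAverage ⟨hf.measurable, h2.symm⟩ hgen hpi ?_, h1⟩
  rintro _ ⟨n, rfl⟩
  -- On the fibre over `α` the limit function `h n` is almost everywhere the constant `α n`.
  refine ⟨k n, α n, hk n, ?_⟩
  filter_upwards [h1, h3 n] with x hx1 hx2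
  rw [← hx1]
  exact hx2

end Ergodic

/-! ### Ergodic decomposition within an extreme level set -/

section Decomposition

open ProbabilityTheory

theorem integrable_and_integral_comp {X Y : Type*} [MeasurableSpace X] [MeasurableSpace Y]
    {κ : Kernel X Y} {β : Measure X} {θ : Y → ℝ}
    (hθ : Integrable θ (κ ∘ₘ β)) :
    (∀ᵐ α ∂β, Integrable θ (κ α)) ∧ Integrable (fun α => ∫ x, θ x ∂κ α) β ∧
      ∫ x, θ x ∂(κ ∘ₘ β) = ∫ α, ∫ x, θ x ∂κ α ∂β := by
  refine ⟨Measure.ae_integrable_of_integrable_comp hθ, ?_, ?_⟩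
  · rw [Measure.comp_eq_comp_const_apply] at hθ
    simpa using hθ.integral_comp
  · rw [Measure.comp_eq_comp_const_apply] at hθ ⊢
    rw [Kernel.integral_comp hθ]
    simp

/-- An almost everywhere one-sided bound by the mean is an equality. -/
theorem ae_eq_integral_of_ae_le_or_ge {X : Type*} [MeasurableSpace X] {β : Measure X}
    [IsProbabilityMeasure β] {g : X → ℝ} (hg : Integrable g β) {c : ℝ} (hc : ∫ x, g x ∂β = c)
    (h : (∀ᵐ x ∂β, g x ≤ c) ∨ ∀ᵐ x ∂β, c ≤ g x) : ∀ᵐ x ∂β, g x = c := by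
  have hconst : ∫ _, c ∂β = c := by simp
  rcases h with h | h
  · exact (integral_eq_iff_of_ae_le hg (integrable_const c) h).1 (hc.trans hconst.symm)
  · exact ((integral_eq_iff_of_ae_le (integrable_const c) hg h).1 (hconst.trans hc.symm)).symm

variable {M : Type*} [MetricSpace M] [CompactSpace M] [MeasurableSpace M] [BorelSpace M]
  {f : M → M} {Ω : Set M} {φ : M → ℝ} {c : ℝ}

theorem hasErgodicDecomposition_of_mem_levelMeasures (hφ : Continuous φ)
    (hne : Ω.Nonempty)
    (hc : (∀ ν ∈ invariantMeasures f Ω, ∫ x, φ x ∂(ν : Measure M) ≤ c) ∨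
      ∀ ν ∈ invariantMeasures f Ω, c ≤ ∫ x, φ x ∂(ν : Measure M))
    {μ : FiniteMeasure M} (hμ : μ ∈ levelMeasures f φ Ω c) :
    HasErgodicDecomposition f (extremePoints ℝ≥0 (levelMeasures f φ Ω c)) μ := by
  have : Nonempty M := hne.to_type
  have hprob := hμ.1.1
  obtain ⟨F, κ, hF, hFf, hκ, hcomp, herg⟩ := exists_ergodic_disintegration hμ.1.2.1
  set β := (μ : Measure M).map F with hβ
  have hβprob : IsProbabilityMeasure β := Measure.isProbabilityMeasure_map hF.aemeasurable
  let κ' : (ℕ → ℝ) → FiniteMeasure M := fun α => ⟨κ α, inferInstance⟩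
  have hΩ : ∀ᵐ α ∂β, κ α Ωᶜ = 0 := by
    have h : ∀ᵐ x ∂(κ ∘ₘ β), x ∈ Ω := by
      rw [hcomp]
      exact hμ.1.2.2
    exact Measure.ae_ae_of_ae_comp h
  have hmem : ∀ᵐ α ∂β, κ' α ∈ invariantMeasures f Ω := by
    filter_upwards [herg, hΩ] with α h1 h2
    exact ⟨inferInstanceAs (IsProbabilityMeasure (κ α)), h1.1.toMeasurePreserving, h2⟩
  have hint : ∀ θ : M → ℝ, Integrable θ (μ : Measure M) → (∀ᵐ α ∂β, Integrable θ (κ α)) ∧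
      Integrable (fun α => ∫ x, θ x ∂κ α) β ∧
      ∫ x, θ x ∂(μ : Measure M) = ∫ α, ∫ x, θ x ∂κ α ∂β := by
    intro θ hθ
    rw [← hcomp] at hθ
    have := integrable_and_integral_comp hθ
    rwa [hcomp] at this
  -- The integrals over the components average to `c` and lie on one side of `c`, so almost all
  -- equal `c`.
  have hlevel : ∀ᵐ α ∂β, ∫ x, φ x ∂κ α = c := by
    obtain ⟨-, h1, h2⟩ := hint φ (integrable_of_continuous hφ _)
    refine ae_eq_integral_of_ae_le_or_ge h1 (h2.symm.trans hμ.2) (hc.imp (fun hc => ?_) fun hc => ?_)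
    · exact hmem.mono fun α hα => hc _ hα
    · exact hmem.mono fun α hα => hc _ hα
  -- The index space is cut down to a measurable conull set on which every property holds without
  -- exception. It is again standard Borel, and the fibres of `F` over it are the invariant pieces.
  obtain ⟨T, hTae, hTm, hT⟩ := ((herg.and hmem).and hlevel).exists_measurable_mem
  set β' : Measure T := β.comap Subtype.val with hβ'
  have hmp : MeasurePreserving (Subtype.val : T → ℕ → ℝ) β' β := by
    refine ⟨measurable_subtype_coe, ?_⟩
    rw [hβ', map_comap_subtype_coe hTm, Measure.restrict_eq_self_of_ae_mem hTae]
  refine ⟨T, inferInstance, hTm.standardBorel, β', fun α => F ⁻¹' {α.1}, fun α => κ' α, ?_, ?_, ?_,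
    ?_, ?_, ?_, ?_, ?_⟩
  · exact ⟨(hmp.measure_preimage (s := univ)
      MeasurableSet.univ.nullMeasurableSet).trans measure_univ⟩
  · intro α
    refine ⟨hF (measurableSet_singleton _), ?_⟩
    ext x
    simp [hFf]
  · intro α α' hαα'
    rw [Set.disjoint_left]
    intro x hx hx'
    exact hαα' (Subtype.ext (hx.symm.trans hx'))
  · intro B hB
    have : ⋃ α ∈ B, F ⁻¹' {α.1} = F ⁻¹' (Subtype.val '' B) := by
      ext x
      simp [eq_comm]
    rw [this]
    exact hF (hTm.subtype_image hB)
  · have : (⋃ α : T, F ⁻¹' {α.1})ᶜ = F ⁻¹' Tᶜ := by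
      ext x
      simp
    rw [this, ← Measure.map_apply hF hTm.compl]
    exact hTae
  · exact κ.measurable.comp measurable_subtype_coe
  · intro α
    obtain ⟨⟨⟨h1, h2⟩, h3⟩, h4⟩ := hT α α.2
    exact ⟨mem_extremePoints_levelMeasures_of_ergodic ⟨h3, h4⟩ h1, h1, h2⟩
  · intro θ hθ
    obtain ⟨h1, h2, h3⟩ := hint θ hθ
    refine ⟨hmp.quasiMeasurePreserving.ae h1, hmp.integrable_comp_of_integrable h2, ?_⟩
    rw [h3]
    exact (hmp.integral_comp (MeasurableEmbedding.subtype_coe hTm) _).symm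

end Decomposition

end ChainAverage

/-! ### The main theorem -/

theorem theorem10 {M : Type*} [MetricSpace M] [CompactSpace M] [MeasurableSpace M] [BorelSpace M]
    (f : M ≃ₜ M) (Ω : Set M) (hΩ : ChainAverage.IsChainComponent f Ω)
    (φ : M → ℝ) (hφ : Continuous φ) :
    ∃ a b : ℝ, a ≤ b ∧
      ChainAverage.averagingSpectrum f φ Ω = Set.Icc a b ∧
      (fun μ : MeasureTheory.FiniteMeasure M => ∫ x, φ x ∂(μ : MeasureTheory.Measure M)) ''
        ChainAverage.invariantMeasures f Ω = Set.Icc a b ∧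
      ∀ c : ℝ, c = a ∨ c = b →
        (ChainAverage.levelMeasures f φ Ω c).Nonempty ∧
        Convex NNReal (ChainAverage.levelMeasures f φ Ω c) ∧
        IsCompact (ChainAverage.levelMeasures f φ Ω c) ∧
        Set.extremePoints NNReal (ChainAverage.levelMeasures f φ Ω c) =
          {μ | μ ∈ ChainAverage.invariantMeasures f Ω ∧
            Ergodic f (μ : MeasureTheory.Measure M) ∧
            ∫ x, φ x ∂(μ : MeasureTheory.Measure M) = c} ∧
        ∀ μ ∈ ChainAverage.levelMeasures f φ Ω c,
          ChainAverage.HasErgodicDecomposition f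
            (Set.extremePoints NNReal (ChainAverage.levelMeasures f φ Ω c)) μ := by
  have hf : Continuous f := f.continuous
  have hspec := hΩ.averagingSpectrum_eq_image hf hφ
  have hinv : (ChainAverage.invariantMeasures f Ω).Nonempty := by
    rw [← Set.image_nonempty, ← hspec]
    exact hΩ.averagingSpectrum_nonempty hf hφ
  obtain ⟨a, b, hab, himage⟩ := ChainAverage.exists_image_integral_eq_Icc hf hφ (hΩ.isClosed hf)
    hΩ.nonempty hinv
  refine ⟨a, b, hab, hspec.trans himage, himage, fun c hc => ?_⟩
  have hmem : c ∈ Set.Icc a b := by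
    rcases hc with rfl | rfl
    exacts [Set.left_mem_Icc.2 hab, Set.right_mem_Icc.2 hab]
  have hbd : ∀ ν ∈ ChainAverage.invariantMeasures f Ω,
      ∫ x, φ x ∂(ν : MeasureTheory.Measure M) ∈ Set.Icc a b := fun ν hν => by
    rw [← himage]
    exact Set.mem_image_of_mem _ hν
  have hface : (∀ ν ∈ ChainAverage.invariantMeasures f Ω,
        ∫ x, φ x ∂(ν : MeasureTheory.Measure M) ≤ c) ∨
      ∀ ν ∈ ChainAverage.invariantMeasures f Ω,
        c ≤ ∫ x, φ x ∂(ν : MeasureTheory.Measure M) := by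
    rcases hc with rfl | rfl
    exacts [Or.inr fun ν hν => (hbd ν hν).1, Or.inl fun ν hν => (hbd ν hν).2]
  rw [← himage] at hmem
  obtain ⟨μ, hμ, hμc⟩ := hmem
  exact ⟨⟨μ, hμ, hμc⟩, ChainAverage.convex_levelMeasures hφ,
    ChainAverage.isCompact_levelMeasures hf hφ (hΩ.isClosed hf) hΩ.nonempty,
    ChainAverage.extremePoints_levelMeasures hφ hface,
    fun ν hν => ChainAverage.hasErgodicDecomposition_of_mem_levelMeasures hφ hΩ.nonempty hface hν⟩
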